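/- Conventions. For $\mathbb F\in\{\mathbb R,\mathbb C\}$, an $\mathbb F$-operator space is an $\mathbb F$-linear subspace $X\subseteq B(\mathcal H)$ for a Hilbert space $\mathcal H$ over $\mathbb F$; it is a unital operator space if it contains the identity operator, and an operator system if moreover it is closed under adjoints. For $(\mathbb F_1,\mathbb F_2)\in\{(\mathbb R,\mathbb R),(\mathbb C,\mathbb C),(\mathbb C,\mathbb R)\}$ (the real, complex and intermediate case), $\mathsf{OSp}_{(\mathbb F_1,\mathbb F_2)}$ (resp. $\mathsf{OSp}^{\mathbb 1}_{(\mathbb F_1,\mathbb F_2)}$, $\mathsf{OSy}_{(\mathbb F_1,\mathbb F_2)}$) is the category whose objects are the $\mathbb F_1$-operator spaces (resp. unital $\mathbb F_1$-operator spaces, $\mathbb F_1$-operator systems) and whose morphisms are the completely contractive (resp. unital completely contractive, unital completely positive) $\mathbb F_2$-linear maps. For a discrete group $G$, the categories $\mathsf{OSp}^{G}_{(\mathbb F_1,\mathbb F_2)}$, $\mathsf{OSp}^{\mathbb 1,G}_{(\mathbb F_1,\mathbb F_2)}$, $\mathsf{OSy}^{G}_{(\mathbb F_1,\mathbb F_2)}$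 have as objects the same spaces with an action of $G$ by $\mathbb F_1$-linear surjective complete isometries (resp. unital surjective complete isometries, unital complete order isomorphisms), and as morphisms the $G$-equivariant morphisms. The complexification functor $\mathcal F_c$ maps a real space $X\subseteq B(\mathcal H)$ to $X_c=X+iX\subseteq B(\mathcal H+i\mathcal H)$ (equivalently, $x+iy$ is normed and ordered as the matrix $\begin{bmatrix}x&-y\\y&x\end{bmatrix}$ over $X$), with the action $g(x+iy)=gx+i\,gy$ if $G$ acts on $X$, and a morphism $T$ to $T_c(x+iy)=T(x)+i\,T(y)$. On the intermediate categories, $\mathcal F_c(X)$ is the complexification of $X$ regarded as a real space. So for each of the six types $\mathsf{OSp}$, $\mathsf{OSp}^{\mathbb 1}$, $\mathsf{OSy}$, $\mathsf{OSp}^{G}$, $\mathsf{OSp}^{\mathbb 1,G}$, $\mathsf{OSy}^{G}$, there is one functor $\mathcal F_c$ from the real to the complex category and one from the intermediate to the complex category, twelve in all. The functors $\mathcal F_0$ forget structure. Theorem. Let $G$ be a discrete group. (1) Each of the twelve complexification functors $\mathcal F_c$ is faithful, is not full, and is not essentially surjective. (2) For each of the six types, the forgetful functor $\mathcal F_0$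 from the complex to the real category (which regards complex spaces and maps as real ones) is not essentially surjective. In fact the quaternions $\mathbb H$, acting on the real Hilbert space $\mathbb H$ by left multiplication, and with trivial $G$-action in the $G$-categories, are a real operator system which is not isomorphic in the real category (of operator spaces, unital operator spaces or operator systems, with or without $G$) to $\mathcal F_0(Z)$ for any object $Z$ of the complex category. (3) In each of the real, complex and intermediate cases, the forgetful functors $\mathcal F_0:\mathsf{OSp}^{\mathbb 1}_{(\mathbb F_1,\mathbb F_2)}\to\mathsf{OSp}_{(\mathbb F_1,\mathbb F_2)}$ and $\mathcal F_0:\mathsf{OSp}^{\mathbb 1,G}_{(\mathbb F_1,\mathbb F_2)}\to\mathsf{OSp}^{G}_{(\mathbb F_1,\mathbb F_2)}$ are not essentially surjective. -/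

import Mathlib

universe u v

namespace OpSp

open scoped InnerProductSpace

section Blocks

variable {𝔽 : Type*} [RCLike 𝔽]
variable {H : Type*} [NormedAddCommGroup H] [InnerProductSpace 𝔽 H]
variable {K : Type*} [NormedAddCommGroup K] [InnerProductSpace 𝔽 K]
variable {ι : Type*} [Fintype ι]

/-- The operator on the Hilbert space direct sum `H ⊕ ⋯ ⊕ H` given by a matrix of operators on `H`:
`(blockOp T v) i = ∑ j, T i j (v j)`. This is the usual identification `M_n(B(H)) = B(Hⁿ)`. -/
noncomputable def blockOp (T : Matrix ι ι (H →L[𝔽] H)) :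
    PiLp 2 (fun _ : ι => H) →L[𝔽] PiLp 2 (fun _ : ι => H) :=
  ((PiLp.continuousLinearEquiv 2 𝔽 (fun _ : ι => H)).symm :
      (ι → H) →L[𝔽] PiLp 2 (fun _ : ι => H)) ∘L
    (ContinuousLinearMap.pi fun i => ∑ j, (T i j) ∘L ContinuousLinearMap.proj j) ∘L
    ((PiLp.continuousLinearEquiv 2 𝔽 (fun _ : ι => H)) : PiLp 2 (fun _ : ι => H) →L[𝔽] (ι → H))

theorem blockOp_apply (T : Matrix ι ι (H →L[𝔽] H)) (v : PiLp 2 (fun _ : ι => H)) (i : ι) :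
    blockOp T v i = ∑ j, T i j (v j) := by
  simp [blockOp]

/-- The operator on `Hⁿ` given by a matrix with entries in a space `X` of operators on `H`. -/
noncomputable def matOp {X : Submodule 𝔽 (H →L[𝔽] H)} (x : Matrix ι ι X) :
    PiLp 2 (fun _ : ι => H) →L[𝔽] PiLp 2 (fun _ : ι => H) :=
  blockOp (x.map fun a => (a : H →L[𝔽] H))

theorem matOp_apply {X : Submodule 𝔽 (H →L[𝔽] H)} (x : Matrix ι ι X)
    (v : PiLp 2 (fun _ : ι => H)) (i : ι) :
    matOp x v i = ∑ j, (x i j : H →L[𝔽] H) (v j) := by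
  simp [matOp, blockOp_apply]

/-- The matrix `x` is positive, as an operator on `Hⁿ`. (Positive operators on a real or complex
Hilbert space are the self-adjoint ones with `0 ≤ ⟪T v, v⟫` for all `v`.) -/
def MatPos {X : Submodule 𝔽 (H →L[𝔽] H)} (x : Matrix ι ι X) : Prop := (matOp x).IsPositive

/-- `f` is completely contractive: `‖[f(x_ij)]‖ ≤ ‖[x_ij]‖` in every matrix size. -/
def CompletelyContractive {X : Submodule 𝔽 (H →L[𝔽] H)} {Y : Submodule 𝔽 (K →L[𝔽] K)}
    (f : X → Y) : Prop :=
  ∀ (n : ℕ) (x : Matrix (Fin n) (Fin n) X), ‖matOp (x.map f)‖ ≤ ‖matOp x‖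

/-- `f` is completely isometric: `‖[f(x_ij)]‖ = ‖[x_ij]‖` in every matrix size. -/
def CompletelyIsometric {X : Submodule 𝔽 (H →L[𝔽] H)} {Y : Submodule 𝔽 (K →L[𝔽] K)}
    (f : X → Y) : Prop :=
  ∀ (n : ℕ) (x : Matrix (Fin n) (Fin n) X), ‖matOp (x.map f)‖ = ‖matOp x‖

/-- `f` is completely positive: it maps positive matrices to positive matrices in every size. -/
def CompletelyPositive {X : Submodule 𝔽 (H →L[𝔽] H)} {Y : Submodule 𝔽 (K →L[𝔽] K)}
    (f : X → Y) : Prop :=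
  ∀ (n : ℕ) (x : Matrix (Fin n) (Fin n) X), MatPos x → MatPos (x.map f)

/-- `f` preserves and reflects positivity of matrices in every size. -/
def CompleteOrderEmbedding {X : Submodule 𝔽 (H →L[𝔽] H)} {Y : Submodule 𝔽 (K →L[𝔽] K)}
    (f : X → Y) : Prop :=
  ∀ (n : ℕ) (x : Matrix (Fin n) (Fin n) X), MatPos (x.map f) ↔ MatPos x

/-- `f` maps the identity operator to the identity operator. -/
def PreservesOne {X : Submodule 𝔽 (H →L[𝔽] H)} {Y : Submodule 𝔽 (K →L[𝔽] K)}
    (f : X → Y) : Prop :=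
  ∀ x : X, (x : H →L[𝔽] H) = 1 → (f x : K →L[𝔽] K) = 1

end Blocks

section Intertwine

variable {𝔽 𝔽' : Type*} [RCLike 𝔽] [RCLike 𝔽']
variable {E F : Type*} [NormedAddCommGroup E] [InnerProductSpace 𝔽 E]
  [NormedAddCommGroup F] [InnerProductSpace 𝔽' F]

theorem opNorm_eq_of_intertwine (A : E →L[𝔽] E) (B : F →L[𝔽'] F) (U : E → F)
    (hU : Function.Surjective U) (hn : ∀ v, ‖U v‖ = ‖v‖) (h : ∀ v, U (A v) = B (U v)) :
    ‖A‖ = ‖B‖ := by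
  apply le_antisymm
  · refine A.opNorm_le_bound (norm_nonneg _) fun v => ?_
    rw [← hn, h, ← hn v]
    exact B.le_opNorm _
  · refine B.opNorm_le_bound (norm_nonneg _) fun v => ?_
    obtain ⟨v, rfl⟩ := hU v
    rw [← h, hn, hn]
    exact A.le_opNorm _

theorem isPositive_iff_re (A : E →L[𝔽] E) : A.IsPositive ↔
    (∀ v w, RCLike.re ⟪A v, w⟫_𝔽 = RCLike.re ⟪v, A w⟫_𝔽) ∧ ∀ v, 0 ≤ RCLike.re ⟪A v, v⟫_𝔽 := by
  constructor
  · rintro ⟨h1, h2⟩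
    exact ⟨fun v w => congrArg RCLike.re (h1 v w), h2⟩
  · rintro ⟨h1, h2⟩
    refine ⟨fun v w => ?_, h2⟩
    apply RCLike.ext (h1 v w)
    have := h1 v ((RCLike.I : 𝔽) • w)
    simpa [inner_smul_right, map_smul] using this

theorem isPositive_iff_of_intertwine (A : E →L[𝔽] E) (B : F →L[𝔽'] F) (U : E → F)
    (hU : Function.Surjective U)
    (hi : ∀ v w, RCLike.re ⟪U v, U w⟫_𝔽' = RCLike.re ⟪v, w⟫_𝔽) (h : ∀ v, U (A v) = B (U v)) :
    A.IsPositive ↔ B.IsPositive := by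
  rw [isPositive_iff_re, isPositive_iff_re]
  constructor
  · rintro ⟨h1, h2⟩
    constructor
    · intro v w
      obtain ⟨v, rfl⟩ := hU v
      obtain ⟨w, rfl⟩ := hU w
      rw [← h, ← h, hi, hi, h1]
    · intro v
      obtain ⟨v, rfl⟩ := hU v
      rw [← h, hi]; exact h2 v
  · rintro ⟨h1, h2⟩
    constructor
    · intro v w
      rw [← hi, ← hi, h, h, h1]
    · intro v
      rw [← hi, h]; exact h2 _

end Intertwine

section Compare

variable {𝔽 𝔽' : Type*} [RCLike 𝔽] [RCLike 𝔽']
variable {H : Type*} [NormedAddCommGroup H] [InnerProductSpace 𝔽 H]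
variable {K : Type*} [NormedAddCommGroup K] [InnerProductSpace 𝔽' K]
variable {ι κ : Type*} [Fintype ι] [Fintype κ]

theorem matOp_compare {X : Submodule 𝔽 (H →L[𝔽] H)} {Y : Submodule 𝔽' (K →L[𝔽'] K)}
    (x : Matrix ι ι X) (y : Matrix κ κ Y)
    (U : PiLp 2 (fun _ : ι => H) → PiLp 2 (fun _ : κ => K)) (hU : Function.Surjective U)
    (hi : ∀ v w, ∑ i, RCLike.re ⟪U v i, U w i⟫_𝔽' = ∑ i, RCLike.re ⟪v i, w i⟫_𝔽)
    (h : ∀ v, U (matOp x v) = matOp y (U v)) :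
    ‖matOp x‖ = ‖matOp y‖ ∧ (MatPos x ↔ MatPos y) := by
  have hi' : ∀ v w, RCLike.re ⟪U v, U w⟫_𝔽' = RCLike.re ⟪v, w⟫_𝔽 := by
    intro v w
    rw [PiLp.inner_apply, PiLp.inner_apply, map_sum, map_sum, hi]
  have hn : ∀ v, ‖U v‖ = ‖v‖ := by
    intro v
    have h := hi' v v
    rw [inner_self_eq_norm_sq, inner_self_eq_norm_sq] at h
    exact (sq_eq_sq₀ (norm_nonneg _) (norm_nonneg _)).1 h
  exact ⟨opNorm_eq_of_intertwine _ _ U hU hn h, isPositive_iff_of_intertwine _ _ U hU hi' h⟩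

end Compare

section Reindex

variable {𝔽 : Type*} [RCLike 𝔽]
variable {H : Type*} [NormedAddCommGroup H] [InnerProductSpace 𝔽 H]
variable {ι κ : Type*} [Fintype ι] [Fintype κ]

theorem matOp_reindex {X : Submodule 𝔽 (H →L[𝔽] H)} (e : κ ≃ ι) (x : Matrix ι ι X) :
    ‖matOp (x.submatrix e e)‖ = ‖matOp x‖ ∧
      (MatPos (x.submatrix e e) ↔ MatPos x) := by
  have hU : Function.Surjective
      (LinearIsometryEquiv.piLpCongrLeft 2 𝔽 H e : PiLp 2 (fun _ : κ => H) → _) :=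
    (LinearIsometryEquiv.piLpCongrLeft 2 𝔽 H e).surjective
  have h : ∀ v, LinearIsometryEquiv.piLpCongrLeft 2 𝔽 H e (matOp (x.submatrix e e) v) =
      matOp x (LinearIsometryEquiv.piLpCongrLeft 2 𝔽 H e v) := by
    intro v
    ext i
    simp only [LinearIsometryEquiv.piLpCongrLeft_apply, Equiv.piCongrLeft'_apply, matOp_apply,
      Matrix.submatrix_apply, Equiv.apply_symm_apply]
    exact Fintype.sum_equiv e _ _ (by simp)
  exact ⟨opNorm_eq_of_intertwine _ _ _ hU (LinearIsometryEquiv.norm_map _) h,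
    isPositive_iff_of_intertwine _ _ _ hU (fun v w => by rw [LinearIsometryEquiv.inner_map_map]) h⟩

end Reindex

section HilbertComplexification

/-- The complexification `H + iH` of a real Hilbert space `H`. -/
@[ext]
structure HilbertC (H : Type*) where
  re : H
  im : H

namespace HilbertC

variable {H : Type*}

/-- The pair of real and imaginary parts. -/
def equivProd (H : Type*) : HilbertC H ≃ H × H where
  toFun v := (v.re, v.im)
  invFun p := ⟨p.1, p.2⟩

variable [NormedAddCommGroup H]

instance : AddCommGroup (HilbertC H) := (equivProd H).addCommGroup

@[simp] theorem re_add (v w : HilbertC H) : (v + w).re = v.re + w.re := rfl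
@[simp] theorem im_add (v w : HilbertC H) : (v + w).im = v.im + w.im := rfl
@[simp] theorem re_zero : (0 : HilbertC H).re = 0 := rfl
@[simp] theorem im_zero : (0 : HilbertC H).im = 0 := rfl

variable [InnerProductSpace ℝ H]

/-- `(a + ib)(x + iy) = (ax - by) + i(ay + bx)`. -/
instance : SMul ℂ (HilbertC H) :=
  ⟨fun c v => ⟨c.re • v.re - c.im • v.im, c.re • v.im + c.im • v.re⟩⟩

@[simp] theorem re_smul (c : ℂ) (v : HilbertC H) : (c • v).re = c.re • v.re - c.im • v.im := rfl
@[simp] theorem im_smul (c : ℂ) (v : HilbertC H) : (c • v).im = c.re • v.im + c.im • v.re := rfl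

instance : Module ℂ (HilbertC H) where
  one_smul v := by ext <;> simp
  mul_smul a b v := by ext <;> simp <;> module
  smul_zero a := by ext <;> simp
  smul_add a v w := by ext <;> simp <;> module
  add_smul a b v := by ext <;> simp <;> module
  zero_smul v := by ext <;> simp

/-- The sesquilinear extension of the real inner product (conjugate linear on the left). -/
noncomputable instance : Inner ℂ (HilbertC H) :=
  ⟨fun v w => ⟨inner ℝ v.re w.re + inner ℝ v.im w.im, inner ℝ v.re w.im - inner ℝ v.im w.re⟩⟩

theorem inner_re (v w : HilbertC H) :
    (inner ℂ v w).re = inner ℝ v.re w.re + inner ℝ v.im w.im := rfl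
theorem inner_im (v w : HilbertC H) :
    (inner ℂ v w).im = inner ℝ v.re w.im - inner ℝ v.im w.re := rfl

/-- The axioms of a complex inner product. -/
@[reducible] noncomputable def core : InnerProductSpace.Core ℂ (HilbertC H) where
  conj_inner_symm v w := by
    apply Complex.ext
    · simp [inner_re, real_inner_comm]
    · simp [inner_im, real_inner_comm]
  re_inner_nonneg v := by
    change 0 ≤ (inner ℂ v v).re
    rw [inner_re]
    exact add_nonneg real_inner_self_nonneg real_inner_self_nonneg
  add_left u v w := by
    apply Complex.ext
    · simp [inner_re, inner_add_left]; ring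
    · simp [inner_im, inner_add_left]; ring
  smul_left v w c := by
    apply Complex.ext
    · simp [inner_re, inner_im, inner_add_left, inner_sub_left, inner_smul_left]; ring
    · simp [inner_re, inner_im, inner_add_left, inner_sub_left, inner_smul_left]; ring
  definite v h := by
    have h' := congrArg Complex.re h
    rw [inner_re] at h'
    have h1 := real_inner_self_nonneg (x := v.re)
    have h2 := real_inner_self_nonneg (x := v.im)
    simp only [Complex.zero_re] at h'
    ext
    · exact inner_self_eq_zero.1 (le_antisymm (by linarith) h1)
    · exact inner_self_eq_zero.1 (le_antisymm (by linarith) h2)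

noncomputable instance : NormedAddCommGroup (HilbertC H) :=
  @InnerProductSpace.Core.toNormedAddCommGroup ℂ (HilbertC H) _ _ _ core

noncomputable instance : InnerProductSpace ℂ (HilbertC H) :=
  InnerProductSpace.ofCore core.toCore

theorem norm_sq (v : HilbertC H) : ‖v‖ ^ 2 = ‖v.re‖ ^ 2 + ‖v.im‖ ^ 2 := by
  rw [← inner_self_eq_norm_sq (𝕜 := ℂ), ← real_inner_self_eq_norm_sq, ← real_inner_self_eq_norm_sq]
  rfl

theorem norm_re_le (v : HilbertC H) : ‖v.re‖ ≤ ‖v‖ :=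
  abs_le_of_sq_le_sq' (by rw [norm_sq]; nlinarith [sq_nonneg ‖v.im‖]) (norm_nonneg _) |>.2

theorem norm_im_le (v : HilbertC H) : ‖v.im‖ ≤ ‖v‖ :=
  abs_le_of_sq_le_sq' (by rw [norm_sq]; nlinarith [sq_nonneg ‖v.re‖]) (norm_nonneg _) |>.2

theorem re_real_smul (r : ℝ) (v : HilbertC H) : (r • v).re = r • v.re := by
  change ((r : ℂ) • v).re = _
  rw [re_smul]; simp

theorem im_real_smul (r : ℝ) (v : HilbertC H) : (r • v).im = r • v.im := by
  change ((r : ℂ) • v).im = _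
  rw [im_smul]; simp

/-- The real part, as a continuous real linear map. -/
noncomputable def reL : HilbertC H →L[ℝ] H :=
  LinearMap.mkContinuous
    { toFun := HilbertC.re
      map_add' := fun _ _ => rfl
      map_smul' := re_real_smul } 1 (fun v => (norm_re_le v).trans_eq (one_mul _).symm)

/-- The imaginary part, as a continuous real linear map. -/
noncomputable def imL : HilbertC H →L[ℝ] H :=
  LinearMap.mkContinuous
    { toFun := HilbertC.im
      map_add' := fun _ _ => rfl
      map_smul' := im_real_smul } 1 (fun v => (norm_im_le v).trans_eq (one_mul _).symm)

theorem norm_mk_zero (x : H) : ‖(⟨x, 0⟩ : HilbertC H)‖ = ‖x‖ := by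
  have h := norm_sq (⟨x, 0⟩ : HilbertC H)
  simp only [norm_zero, ne_eq, OfNat.ofNat_ne_zero, not_false_eq_true, zero_pow, add_zero] at h
  exact (sq_eq_sq₀ (norm_nonneg _) (norm_nonneg _)).1 h

/-- The inclusion of `H` in `H + iH`, as a continuous real linear map. -/
noncomputable def inclL : H →L[ℝ] HilbertC H :=
  LinearMap.mkContinuous
    { toFun := fun x => ⟨x, 0⟩
      map_add' := fun x y => by ext <;> simp
      map_smul' := fun r x => by
        ext <;> simp [re_real_smul, im_real_smul] } 1 (fun x => by simp [norm_mk_zero])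

@[simp] theorem reL_apply (v : HilbertC H) : reL v = v.re := rfl
@[simp] theorem imL_apply (v : HilbertC H) : imL v = v.im := rfl
@[simp] theorem inclL_re (x : H) : (inclL x).re = x := rfl
@[simp] theorem inclL_im (x : H) : (inclL x).im = 0 := rfl

instance [CompleteSpace H] : CompleteSpace (HilbertC H) := by
  apply Metric.complete_of_cauchySeq_tendsto
  intro s hs
  obtain ⟨a, ha⟩ := cauchySeq_tendsto_of_complete (reL.uniformContinuous.comp_cauchySeq hs)
  obtain ⟨b, hb⟩ := cauchySeq_tendsto_of_complete (imL.uniformContinuous.comp_cauchySeq hs)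
  refine ⟨inclL a + Complex.I • inclL b, ?_⟩
  have h1 := (inclL.continuous.tendsto a).comp ha
  have h2 := ((inclL.continuous.tendsto b).comp hb).const_smul Complex.I
  refine (h1.add h2).congr fun n => ?_
  ext <;> simp

end HilbertC

end HilbertComplexification

section OperatorComplexification

variable {H : Type*} [NormedAddCommGroup H] [InnerProductSpace ℝ H]

/-- The complex linear extension `v + iw ↦ T v + i T w` of a bounded operator on `H`
to `H + iH`. -/
noncomputable def extendOp (T : H →L[ℝ] H) : HilbertC H →L[ℂ] HilbertC H :=
  LinearMap.mkContinuous
    { toFun := fun v => ⟨T v.re, T v.im⟩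
      map_add' := fun v w => by ext <;> simp
      map_smul' := fun c v => by ext <;> simp } ‖T‖ (fun v => by
        apply le_of_sq_le_sq _ (by positivity)
        rw [mul_pow, HilbertC.norm_sq, HilbertC.norm_sq]
        have h1 := pow_le_pow_left₀ (norm_nonneg _) (T.le_opNorm v.re) 2
        have h2 := pow_le_pow_left₀ (norm_nonneg _) (T.le_opNorm v.im) 2
        simp only [LinearMap.coe_mk, AddHom.coe_mk]
        rw [mul_pow] at h1 h2
        linarith)

@[simp] theorem extendOp_re (T : H →L[ℝ] H) (v : HilbertC H) : (extendOp T v).re = T v.re := rfl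
@[simp] theorem extendOp_im (T : H →L[ℝ] H) (v : HilbertC H) : (extendOp T v).im = T v.im := rfl

/-- The operator `x + iy` on `H + iH`, for operators `x`, `y` on `H`. -/
noncomputable def combine (x y : H →L[ℝ] H) : HilbertC H →L[ℂ] HilbertC H :=
  extendOp x + Complex.I • extendOp y

@[simp] theorem combine_re (x y : H →L[ℝ] H) (v : HilbertC H) :
    (combine x y v).re = x v.re - y v.im := by
  simp [combine, sub_eq_add_neg]
@[simp] theorem combine_im (x y : H →L[ℝ] H) (v : HilbertC H) :
    (combine x y v).im = x v.im + y v.re := by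
  simp [combine]

/-- The operator `x`, when the argument is `x + iy`. -/
noncomputable def rePart (S : HilbertC H →L[ℂ] HilbertC H) : H →L[ℝ] H :=
  HilbertC.reL ∘L (S.restrictScalars ℝ) ∘L HilbertC.inclL

/-- The operator `y`, when the argument is `x + iy`. -/
noncomputable def imPart (S : HilbertC H →L[ℂ] HilbertC H) : H →L[ℝ] H :=
  HilbertC.imL ∘L (S.restrictScalars ℝ) ∘L HilbertC.inclL

@[simp] theorem rePart_combine (x y : H →L[ℝ] H) : rePart (combine x y) = x := by
  ext v; simp [rePart]
@[simp] theorem imPart_combine (x y : H →L[ℝ] H) : imPart (combine x y) = y := by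
  ext v; simp [imPart]

theorem combine_add (x y x' y' : H →L[ℝ] H) :
    combine x y + combine x' y' = combine (x + x') (y + y') := by
  ext v <;> simp <;> abel

theorem smul_combine (c : ℂ) (x y : H →L[ℝ] H) :
    c • combine x y = combine (c.re • x - c.im • y) (c.re • y + c.im • x) := by
  ext v <;> simp <;> module

theorem combine_one_zero : combine (1 : H →L[ℝ] H) 0 = 1 := by
  ext v <;> simp

theorem combine_eq_one_iff (x y : H →L[ℝ] H) : combine x y = 1 ↔ x = 1 ∧ y = 0 := by
  constructor
  · intro h
    rw [← combine_one_zero] at h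
    exact ⟨by simpa using congrArg rePart h, by simpa using congrArg imPart h⟩
  · rintro ⟨rfl, rfl⟩; exact combine_one_zero

theorem star_combine [CompleteSpace H] (x y : H →L[ℝ] H) :
    star (combine x y) = combine (star x) (-star y) := by
  rw [ContinuousLinearMap.star_eq_adjoint (combine x y)]
  symm
  rw [ContinuousLinearMap.eq_adjoint_iff]
  intro v w
  apply Complex.ext
  · simp [HilbertC.inner_re, inner_add_left, inner_add_right, inner_sub_right,
      ContinuousLinearMap.star_eq_adjoint, ContinuousLinearMap.adjoint_inner_left]
    ring
  · simp [HilbertC.inner_im, inner_add_left, inner_add_right, inner_sub_right,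
      ContinuousLinearMap.star_eq_adjoint, ContinuousLinearMap.adjoint_inner_left]
    ring

/-- The complexification `X + iX` of a space `X` of operators on `H`, as a space of operators on
`H + iH`. As `x + iy` acts on `H + iH = H ⊕ H` by the matrix with rows `(x, -y)` and `(y, x)`,
this is the canonical operator space complexification of `X`. -/
def complexifySpace (X : Submodule ℝ (H →L[ℝ] H)) :
    Submodule ℂ (HilbertC H →L[ℂ] HilbertC H) where
  carrier := {S | ∃ x ∈ X, ∃ y ∈ X, S = combine x y}
  add_mem' := by
    rintro _ _ ⟨x, hx, y, hy, rfl⟩ ⟨x', hx', y', hy', rfl⟩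
    exact ⟨_, X.add_mem hx hx', _, X.add_mem hy hy', combine_add _ _ _ _⟩
  zero_mem' := ⟨0, X.zero_mem, 0, X.zero_mem, by ext v <;> simp⟩
  smul_mem' := by
    rintro c _ ⟨x, hx, y, hy, rfl⟩
    exact ⟨_, X.sub_mem (X.smul_mem _ hx) (X.smul_mem _ hy), _,
      X.add_mem (X.smul_mem _ hy) (X.smul_mem _ hx), smul_combine _ _ _⟩

variable {X : Submodule ℝ (H →L[ℝ] H)}

/-- The element `x` of `X`, for the element `x + iy` of `X + iX`. -/
noncomputable def reX (s : complexifySpace X) : X :=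
  ⟨rePart (s : HilbertC H →L[ℂ] HilbertC H), by
    obtain ⟨_, x, hx, y, hy, rfl⟩ := s; simpa using hx⟩

/-- The element `y` of `X`, for the element `x + iy` of `X + iX`. -/
noncomputable def imX (s : complexifySpace X) : X :=
  ⟨imPart (s : HilbertC H →L[ℂ] HilbertC H), by
    obtain ⟨_, x, hx, y, hy, rfl⟩ := s; simpa using hy⟩

/-- The element `x + iy` of `X + iX`, for `x` and `y` in `X`. -/
noncomputable def mkX (x y : X) : complexifySpace X :=
  ⟨combine x y, x, x.2, y, y.2, rfl⟩

@[simp] theorem reX_mkX (x y : X) : reX (mkX x y) = x := Subtype.ext (rePart_combine _ _)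
@[simp] theorem imX_mkX (x y : X) : imX (mkX x y) = y := Subtype.ext (imPart_combine _ _)
@[simp] theorem mkX_eta (s : complexifySpace X) : mkX (reX s) (imX s) = s := by
  obtain ⟨_, x, hx, y, hy, rfl⟩ := s
  apply Subtype.ext
  simp [mkX, reX, imX]

theorem mkX_add (x y x' y' : X) : mkX x y + mkX x' y' = mkX (x + x') (y + y') :=
  Subtype.ext (combine_add _ _ _ _)

theorem smul_mkX (c : ℂ) (x y : X) :
    c • mkX x y = mkX (c.re • x - c.im • y) (c.re • y + c.im • x) :=
  Subtype.ext (smul_combine _ _ _)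

theorem coe_eq_combine (s : complexifySpace X) :
    (s : HilbertC H →L[ℂ] HilbertC H) = combine (reX s) (imX s) :=
  congrArg Subtype.val (mkX_eta s).symm

variable {K : Type*} [NormedAddCommGroup K] [InnerProductSpace ℝ K]
variable {Y : Submodule ℝ (K →L[ℝ] K)}

/-- The complexification `f_c (x + iy) = f x + i f y` of a map `f`. -/
noncomputable def complexifyFun (f : X → Y) (s : complexifySpace X) : complexifySpace Y :=
  mkX (f (reX s)) (f (imX s))

/-- The real matrix with blocks `x`, `-y` / `y`, `x`, for a matrix `x + iy` over `X + iX`. -/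
noncomputable def realBlocks {ι : Type*} (s : Matrix ι ι (complexifySpace X)) :
    Matrix (ι ⊕ ι) (ι ⊕ ι) X :=
  Matrix.fromBlocks (s.map reX) (-(s.map imX)) (s.map imX) (s.map reX)

theorem matOp_realBlocks {ι : Type*} [Fintype ι] (s : Matrix ι ι (complexifySpace X)) :
    ‖matOp s‖ = ‖matOp (realBlocks s)‖ ∧
      (MatPos s ↔ MatPos (realBlocks s)) := by
  let U : PiLp 2 (fun _ : ι => HilbertC H) → PiLp 2 (fun _ : ι ⊕ ι => H) := fun v =>
    WithLp.toLp 2 (Sum.elim (fun i => (v i).re) (fun i => (v i).im))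
  have hU : Function.Surjective U := fun w =>
    ⟨WithLp.toLp 2 fun i => ⟨w (Sum.inl i), w (Sum.inr i)⟩, by ext (i | i) <;> rfl⟩
  have hi : ∀ v w, RCLike.re (inner ℝ (U v) (U w)) = RCLike.re (inner ℂ v w) := by
    intro v w
    simp [U, PiLp.inner_apply, HilbertC.inner_re, Finset.sum_add_distrib]
  have hn : ∀ v, ‖U v‖ = ‖v‖ := by
    intro v
    have h := hi v v
    rw [inner_self_eq_norm_sq, inner_self_eq_norm_sq] at h
    exact (sq_eq_sq₀ (norm_nonneg _) (norm_nonneg _)).1 h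
  have reL_eq : ∀ w : HilbertC H, HilbertC.reL w = w.re := fun _ => rfl
  have h : ∀ v, U (matOp s v) = matOp (realBlocks s) (U v) := by
    intro v
    ext (i | i)
    · simp only [U, matOp_apply, Sum.elim_inl, Fintype.sum_sum_type, realBlocks,
        Matrix.fromBlocks_apply₁₁, Matrix.fromBlocks_apply₁₂, Matrix.map_apply, Sum.elim_inr,
        Matrix.neg_apply]
      rw [← HilbertC.reL_apply, map_sum, ← Finset.sum_add_distrib]
      refine Finset.sum_congr rfl fun j _ => ?_
      rw [coe_eq_combine]
      simp [sub_eq_add_neg]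
    · simp only [U, matOp_apply, Sum.elim_inl, Fintype.sum_sum_type, realBlocks,
        Matrix.fromBlocks_apply₂₁, Matrix.fromBlocks_apply₂₂, Matrix.map_apply, Sum.elim_inr]
      rw [← HilbertC.imL_apply, map_sum, ← Finset.sum_add_distrib]
      refine Finset.sum_congr rfl fun j _ => ?_
      rw [coe_eq_combine]
      simp [add_comm]
  exact ⟨opNorm_eq_of_intertwine _ _ U hU hn h, isPositive_iff_of_intertwine _ _ U hU hi h⟩

theorem realBlocks_map {ι : Type*} (f : X →+ Y) (s : Matrix ι ι (complexifySpace X)) :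
    realBlocks (s.map (complexifyFun f)) = (realBlocks s).map f := by
  ext (i | i) (j | j) : 2 <;> simp [realBlocks, complexifyFun]

/-- Matrices over `X + iX` of size `n` are, compatibly with norm, positivity and with maps,
matrices over `X` of size `n + n`. -/
theorem exists_real_matrix (n : ℕ) (s : Matrix (Fin n) (Fin n) (complexifySpace X)) :
    ∃ x : Matrix (Fin (n + n)) (Fin (n + n)) X,
      (‖matOp s‖ = ‖matOp x‖ ∧ (MatPos s ↔ MatPos x)) ∧
      ∀ f : X →+ Y, ‖matOp (s.map (complexifyFun f))‖ = ‖matOp (x.map f)‖ ∧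
        (MatPos (s.map (complexifyFun f)) ↔ MatPos (x.map f)) := by
  have key : ∀ {L : Type _} [NormedAddCommGroup L] [InnerProductSpace ℝ L]
      {Z : Submodule ℝ (L →L[ℝ] L)} (t : Matrix (Fin n) (Fin n) (complexifySpace Z)),
      ‖matOp t‖ = ‖matOp ((realBlocks t).submatrix finSumFinEquiv.symm finSumFinEquiv.symm)‖ ∧
      (MatPos t ↔
        MatPos ((realBlocks t).submatrix finSumFinEquiv.symm finSumFinEquiv.symm)) := by
    intro L _ _ Z t
    have h1 := matOp_realBlocks t
    have h2 := matOp_reindex finSumFinEquiv.symm (realBlocks t)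
    exact ⟨h1.1.trans h2.1.symm, h1.2.trans h2.2.symm⟩
  refine ⟨(realBlocks s).submatrix finSumFinEquiv.symm finSumFinEquiv.symm, ?_, fun f => ?_⟩
  · have h1 := matOp_realBlocks s
    have h2 := matOp_reindex finSumFinEquiv.symm (realBlocks s)
    exact ⟨h1.1.trans h2.1.symm, h1.2.trans h2.2.symm⟩
  · have h := key (s.map (complexifyFun f))
    rw [realBlocks_map] at h
    exact h

end OperatorComplexification

section Realification

attribute [local instance] InnerProductSpace.complexToReal

variable {H : Type*} [NormedAddCommGroup H] [InnerProductSpace ℂ H]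
variable {K : Type*} [NormedAddCommGroup K] [InnerProductSpace ℂ K]

/-- A complex space `X` of operators on a complex Hilbert space `H`, as a real space of operators
on the underlying real Hilbert space of `H` (with inner product `re ⟪v, w⟫`). -/
def realSpace (X : Submodule ℂ (H →L[ℂ] H)) : Submodule ℝ (H →L[ℝ] H) where
  carrier := {T | ∃ x ∈ X, T = x.restrictScalars ℝ}
  add_mem' := by
    rintro _ _ ⟨x, hx, rfl⟩ ⟨y, hy, rfl⟩
    exact ⟨x + y, X.add_mem hx hy, rfl⟩
  zero_mem' := ⟨0, X.zero_mem, rfl⟩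
  smul_mem' := by
    rintro r _ ⟨x, hx, rfl⟩
    exact ⟨(r : ℂ) • x, X.smul_mem _ hx, by ext v; simp⟩

variable {X : Submodule ℂ (H →L[ℂ] H)} {Y : Submodule ℂ (K →L[ℂ] K)}

/-- The identity map from `X` to `X` regarded as a real operator space. -/
noncomputable def realEquiv (X : Submodule ℂ (H →L[ℂ] H)) : X ≃+ realSpace X :=
  { Equiv.ofBijective
      (fun x : X => (⟨(x : H →L[ℂ] H).restrictScalars ℝ, x, x.2, rfl⟩ : realSpace X))
      ⟨fun x y h => by
        apply Subtype.ext
        ext v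
        exact DFunLike.congr_fun (congrArg Subtype.val h) v,
      fun ⟨_, x, hx, h⟩ => ⟨⟨x, hx⟩, Subtype.ext h.symm⟩⟩ with
    map_add' := fun _ _ => rfl }

theorem realEquiv_coe_apply (x : X) (v : H) :
    (realEquiv X x : H →L[ℝ] H) v = (x : H →L[ℂ] H) v := rfl

theorem realEquiv_symm_coe_apply (x : realSpace X) (v : H) :
    ((realEquiv X).symm x : H →L[ℂ] H) v = (x : H →L[ℝ] H) v := by
  rw [← realEquiv_coe_apply, AddEquiv.apply_symm_apply]

theorem realEquiv_smul (r : ℝ) (x : X) : realEquiv X ((r : ℂ) • x) = r • realEquiv X x := by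
  apply Subtype.ext
  ext v
  rw [realEquiv_coe_apply]
  simp [realEquiv_coe_apply]

theorem realEquiv_symm_smul (r : ℝ) (x : realSpace X) :
    (realEquiv X).symm (r • x) = (r : ℂ) • (realEquiv X).symm x := by
  rw [AddEquiv.symm_apply_eq, realEquiv_smul, AddEquiv.apply_symm_apply]

theorem star_restrictScalars [CompleteSpace H] (T : H →L[ℂ] H) :
    star (T.restrictScalars ℝ) = (star T).restrictScalars ℝ := by
  rw [ContinuousLinearMap.star_eq_adjoint (T.restrictScalars ℝ)]
  symm
  rw [ContinuousLinearMap.eq_adjoint_iff]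
  intro v w
  change (inner ℂ ((star T) v) w).re = (inner ℂ v (T w)).re
  rw [ContinuousLinearMap.star_eq_adjoint, ContinuousLinearMap.adjoint_inner_left]

theorem matOp_real {ι : Type*} [Fintype ι] (x : Matrix ι ι (realSpace X)) :
    ‖matOp x‖ = ‖matOp (x.map (realEquiv X).symm)‖ ∧
      (MatPos x ↔ MatPos (x.map (realEquiv X).symm)) := by
  have h : ∀ v, id (matOp x v) = matOp (x.map (realEquiv X).symm) (id v) := by
    intro v
    ext i
    simp only [id, matOp_apply, Matrix.map_apply, realEquiv_symm_coe_apply]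
  exact matOp_compare _ _ id Function.surjective_id (fun _ _ => rfl) h

/-- A map between complex spaces, regarded as a map between real spaces. -/
noncomputable def realFun (f : X →+ Y) : realSpace X →+ realSpace Y :=
  (realEquiv Y).toAddMonoidHom.comp (f.comp (realEquiv X).symm.toAddMonoidHom)

theorem realFun_apply (f : X →+ Y) (x : realSpace X) :
    realFun f x = realEquiv Y (f ((realEquiv X).symm x)) := rfl

theorem realFun_map {ι : Type*} (f : X →+ Y) (x : Matrix ι ι (realSpace X)) :
    (x.map (realFun f)).map (realEquiv Y).symm = (x.map (realEquiv X).symm).map f := by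
  ext i j : 2
  simp [realFun_apply]

end Realification

/-- The three kinds of spaces. -/
inductive OpKind
  /-- operator spaces -/
  | space
  /-- unital operator spaces -/
  | unital
  /-- operator systems -/
  | system

section Kinds

variable {𝔽 : Type*} [RCLike 𝔽]
variable {H : Type*} [NormedAddCommGroup H] [InnerProductSpace 𝔽 H]
variable {K : Type*} [NormedAddCommGroup K] [InnerProductSpace 𝔽 K]

/-- The maps used as morphisms: completely contractive maps of operator spaces, unital completely
contractive maps of unital operator spaces, unital completely positive maps of operator systems. -/
def IsMorphism (k : OpKind) {X : Submodule 𝔽 (H →L[𝔽] H)} {Y : Submodule 𝔽 (K →L[𝔽] K)}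
    (f : X → Y) : Prop :=
  match k with
  | .space => CompletelyContractive f
  | .unital => PreservesOne f ∧ CompletelyContractive f
  | .system => PreservesOne f ∧ CompletelyPositive f

/-- The maps by which groups act: complete isometries of operator spaces, unital complete
isometries of unital operator spaces, unital complete order isomorphisms of operator systems
(surjectivity is automatic for the elements of a group action). -/
def IsSymmetry (k : OpKind) {X : Submodule 𝔽 (H →L[𝔽] H)} (f : X → X) : Prop :=
  match k with
  | .space => CompletelyIsometric f
  | .unital => PreservesOne f ∧ CompletelyIsometric f
  | .system => PreservesOne f ∧ CompleteOrderEmbedding f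

theorem IsMorphism.id (k : OpKind) (X : Submodule 𝔽 (H →L[𝔽] H)) :
    IsMorphism k (fun x : X => x) := by
  cases k
  · exact fun _ _ => le_rfl
  · exact ⟨fun _ h => h, fun _ _ => le_rfl⟩
  · exact ⟨fun _ h => h, fun _ _ h => h⟩

theorem IsMorphism.comp {L : Type*} [NormedAddCommGroup L] [InnerProductSpace 𝔽 L] {k : OpKind}
    {X : Submodule 𝔽 (H →L[𝔽] H)} {Y : Submodule 𝔽 (K →L[𝔽] K)} {Z : Submodule 𝔽 (L →L[𝔽] L)}
    {f : X → Y} {g : Y → Z} (hg : IsMorphism k g) (hf : IsMorphism k f) :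
    IsMorphism k (fun x => g (f x)) := by
  cases k
  · exact fun n x => (hg n (x.map f)).trans (hf n x)
  · exact ⟨fun x h => hg.1 _ (hf.1 x h), fun n x => (hg.2 n (x.map f)).trans (hf.2 n x)⟩
  · exact ⟨fun x h => hg.1 _ (hf.1 x h), fun n x h => hg.2 n (x.map f) (hf.2 n x h)⟩

theorem IsSymmetry.id (k : OpKind) (X : Submodule 𝔽 (H →L[𝔽] H)) :
    IsSymmetry k (fun x : X => x) := by
  cases k
  · exact fun _ _ => rfl
  · exact ⟨fun _ h => h, fun _ _ => rfl⟩
  · exact ⟨fun _ h => h, fun _ _ => Iff.rfl⟩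

end Kinds

section Transfer

theorem PreservesOne.complexify {H K : Type*} [NormedAddCommGroup H] [InnerProductSpace ℝ H]
    [NormedAddCommGroup K] [InnerProductSpace ℝ K] {X : Submodule ℝ (H →L[ℝ] H)}
    {Y : Submodule ℝ (K →L[ℝ] K)} {f : X →+ Y} (hf : PreservesOne f) :
    PreservesOne (complexifyFun f) := by
  intro s hs
  rw [coe_eq_combine, combine_eq_one_iff] at hs
  change combine _ _ = 1
  rw [combine_eq_one_iff]
  refine ⟨hf _ hs.1, ?_⟩
  have : imX s = 0 := Subtype.ext hs.2
  rw [this, map_zero]; rfl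

theorem IsMorphism.complexify {H K : Type*} [NormedAddCommGroup H] [InnerProductSpace ℝ H]
    [NormedAddCommGroup K] [InnerProductSpace ℝ K] {k : OpKind} {X : Submodule ℝ (H →L[ℝ] H)}
    {Y : Submodule ℝ (K →L[ℝ] K)} {f : X →+ Y} (hf : IsMorphism k f) :
    IsMorphism k (complexifyFun f) := by
  have hc (h : CompletelyContractive f) : CompletelyContractive (complexifyFun f) := by
    intro n s
    obtain ⟨x, h1, h2⟩ := exists_real_matrix (Y := Y) n s
    rw [h1.1, (h2 f).1]; exact h _ _
  cases k
  · exact hc hf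
  · exact ⟨hf.1.complexify, hc hf.2⟩
  · refine ⟨hf.1.complexify, fun n s => ?_⟩
    obtain ⟨x, h1, h2⟩ := exists_real_matrix (Y := Y) n s
    rw [h1.2, (h2 f).2]; exact hf.2 _ _

theorem IsSymmetry.complexify {H : Type*} [NormedAddCommGroup H] [InnerProductSpace ℝ H]
    {k : OpKind} {X : Submodule ℝ (H →L[ℝ] H)} {f : X →+ X} (hf : IsSymmetry k f) :
    IsSymmetry k (complexifyFun f) := by
  have hc (h : CompletelyIsometric f) : CompletelyIsometric (complexifyFun f) := by
    intro n s
    obtain ⟨x, h1, h2⟩ := exists_real_matrix (Y := X) n s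
    rw [h1.1, (h2 f).1]; exact h _ _
  cases k
  · exact hc hf
  · exact ⟨hf.1.complexify, hc hf.2⟩
  · refine ⟨hf.1.complexify, fun n s => ?_⟩
    obtain ⟨x, h1, h2⟩ := exists_real_matrix (Y := X) n s
    rw [h1.2, (h2 f).2]; exact hf.2 _ _

attribute [local instance] InnerProductSpace.complexToReal

theorem PreservesOne.real {H K : Type*} [NormedAddCommGroup H] [InnerProductSpace ℂ H]
    [NormedAddCommGroup K] [InnerProductSpace ℂ K] {X : Submodule ℂ (H →L[ℂ] H)}
    {Y : Submodule ℂ (K →L[ℂ] K)} {f : X →+ Y} (hf : PreservesOne f) :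
    PreservesOne (realFun f) := by
  intro x hx
  have h1 : ((realEquiv X).symm x : H →L[ℂ] H) = 1 := by
    ext v
    rw [realEquiv_symm_coe_apply, hx]; rfl
  ext v
  rw [realFun_apply, realEquiv_coe_apply, hf _ h1]; rfl

theorem IsMorphism.real {H K : Type*} [NormedAddCommGroup H] [InnerProductSpace ℂ H]
    [NormedAddCommGroup K] [InnerProductSpace ℂ K] {k : OpKind} {X : Submodule ℂ (H →L[ℂ] H)}
    {Y : Submodule ℂ (K →L[ℂ] K)} {f : X →+ Y} (hf : IsMorphism k f) :
    IsMorphism k (realFun f) := by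
  have hc (h : CompletelyContractive f) : CompletelyContractive (realFun f) := by
    intro n x
    rw [(matOp_real x).1, (matOp_real _).1, realFun_map]; exact h _ _
  cases k
  · exact hc hf
  · exact ⟨hf.1.real, hc hf.2⟩
  · refine ⟨hf.1.real, fun n x => ?_⟩
    rw [(matOp_real x).2, (matOp_real _).2, realFun_map]; exact hf.2 _ _

theorem IsSymmetry.real {H : Type*} [NormedAddCommGroup H] [InnerProductSpace ℂ H]
    {k : OpKind} {X : Submodule ℂ (H →L[ℂ] H)} {f : X →+ X} (hf : IsSymmetry k f) :
    IsSymmetry k (realFun f) := by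
  have hc (h : CompletelyIsometric f) : CompletelyIsometric (realFun f) := by
    intro n x
    rw [(matOp_real x).1, (matOp_real _).1, realFun_map]; exact h _ _
  cases k
  · exact hc hf
  · exact ⟨hf.1.real, hc hf.2⟩
  · refine ⟨hf.1.real, fun n x => ?_⟩
    rw [(matOp_real x).2, (matOp_real _).2, realFun_map]; exact hf.2 _ _

end Transfer

section Categories

open CategoryTheory

/-- The objects of `OSp_(𝔽₁,𝔽₂)` (`k = .space`), `OSp^𝟙_(𝔽₁,𝔽₂)` (`k = .unital`) and
`OSy_(𝔽₁,𝔽₂)` (`k = .system`): subspaces of `B(H)` for a Hilbert space `H` over `𝔽₁`, which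
contain the identity if `k` is not `.space`, and are self-adjoint if `k` is `.system`. The field
`𝔽₂` only enters the definition of the morphisms. -/
structure OpCat (k : OpKind) (𝔽₁ 𝔽₂ : Type) [RCLike 𝔽₁] : Type (u + 1) where
  /-- the Hilbert space -/
  H : Type u
  [normed : NormedAddCommGroup H]
  [innerProd : InnerProductSpace 𝔽₁ H]
  [complete : CompleteSpace H]
  /-- the space of operators -/
  X : Submodule 𝔽₁ (H →L[𝔽₁] H)
  one_mem : k ≠ .space → (1 : H →L[𝔽₁] H) ∈ X
  star_mem : k = .system → ∀ x ∈ X, star x ∈ X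

attribute [instance] OpCat.normed OpCat.innerProd OpCat.complete

/-- The objects of `OSp^G_(𝔽₁,𝔽₂)`, `OSp^{𝟙,G}_(𝔽₁,𝔽₂)` and `OSy^G_(𝔽₁,𝔽₂)`: objects as above,
on which the group `G` acts by `𝔽₁`-linear complete isometries, unital complete isometries,
or unital complete order isomorphisms, respectively. -/
structure GOpCat (G : Type v) [Group G] (k : OpKind) (𝔽₁ 𝔽₂ : Type) [RCLike 𝔽₁] extends
    OpCat.{u} k 𝔽₁ 𝔽₂ where
  /-- the action -/
  ρ : Representation 𝔽₁ G X
  isSymmetry : ∀ g, IsSymmetry k (ρ g)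

variable {k : OpKind} {𝔽₁ 𝔽₂ : Type} [RCLike 𝔽₁] [Field 𝔽₂] [Algebra 𝔽₂ 𝔽₁]

/-- The morphisms: `𝔽₂`-linear maps that are completely contractive, unital completely contractive,
or unital completely positive, respectively. -/
@[ext]
structure OpHom (A B : OpCat.{u} k 𝔽₁ 𝔽₂) where
  /-- the underlying additive map -/
  hom : A.X →+ B.X
  map_smul : ∀ (c : 𝔽₂) (x : A.X), hom (algebraMap 𝔽₂ 𝔽₁ c • x) = algebraMap 𝔽₂ 𝔽₁ c • hom x
  isMorphism : IsMorphism k hom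

instance : Category (OpCat.{u} k 𝔽₁ 𝔽₂) where
  Hom A B := OpHom A B
  id A := ⟨AddMonoidHom.id A.X, fun _ _ => rfl, IsMorphism.id k A.X⟩
  comp f g := ⟨g.hom.comp f.hom, fun c x =>
    (congrArg g.hom (f.map_smul c x)).trans (g.map_smul c (f.hom x)),
    g.isMorphism.comp f.isMorphism⟩

variable {G : Type v} [Group G]

/-- The morphisms of the `G`-categories: morphisms as above that are `G`-equivariant. -/
@[ext]
structure GOpHom (A B : GOpCat.{u} G k 𝔽₁ 𝔽₂) extends OpHom A.toOpCat B.toOpCat where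
  equivariant : ∀ (g : G) (x : A.X), hom (A.ρ g x) = B.ρ g (hom x)

instance : Category (GOpCat.{u} G k 𝔽₁ 𝔽₂) where
  Hom A B := GOpHom A B
  id A := ⟨⟨AddMonoidHom.id A.X, fun _ _ => rfl, IsMorphism.id k A.X⟩, fun _ _ => rfl⟩
  comp f g := ⟨⟨g.hom.comp f.hom, fun c x =>
    (congrArg g.hom (f.map_smul c x)).trans (g.map_smul c (f.hom x)),
    g.isMorphism.comp f.isMorphism⟩, fun a x =>
    (congrArg g.hom (f.equivariant a x)).trans (g.equivariant a (f.hom x))⟩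

/-- An object with the trivial action of `G`. -/
def OpCat.trivialAction (G : Type v) [Group G] (A : OpCat.{u} k 𝔽₁ 𝔽₂) :
    GOpCat.{u} G k 𝔽₁ 𝔽₂ where
  toOpCat := A
  ρ := Representation.trivial 𝔽₁ G A.X
  isSymmetry _ := IsSymmetry.id k A.X

end Categories

section ComplexifyFunctor

open CategoryTheory

section Maps

variable {H K : Type*} [NormedAddCommGroup H] [InnerProductSpace ℝ H]
  [NormedAddCommGroup K] [InnerProductSpace ℝ K]
  {X : Submodule ℝ (H →L[ℝ] H)} {Y : Submodule ℝ (K →L[ℝ] K)}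

theorem reX_add (s t : complexifySpace X) : reX (s + t) = reX s + reX t := by
  conv_lhs => rw [← mkX_eta s, ← mkX_eta t, mkX_add, reX_mkX]

theorem imX_add (s t : complexifySpace X) : imX (s + t) = imX s + imX t := by
  conv_lhs => rw [← mkX_eta s, ← mkX_eta t, mkX_add, imX_mkX]

theorem reX_smul (c : ℂ) (s : complexifySpace X) :
    reX (c • s) = c.re • reX s - c.im • imX s := by
  conv_lhs => rw [← mkX_eta s, smul_mkX, reX_mkX]

theorem imX_smul (c : ℂ) (s : complexifySpace X) :
    imX (c • s) = c.re • imX s + c.im • reX s := by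
  conv_lhs => rw [← mkX_eta s, smul_mkX, imX_mkX]

theorem complexifyFun_comp {L : Type*} [NormedAddCommGroup L] [InnerProductSpace ℝ L]
    {Z : Submodule ℝ (L →L[ℝ] L)} (g : Y → Z) (f : X → Y) (s : complexifySpace X) :
    complexifyFun (fun x => g (f x)) s = complexifyFun g (complexifyFun f s) := by
  simp only [complexifyFun, reX_mkX, imX_mkX]

/-- The complexification `x + iy ↦ f x + i f y` of an additive map. -/
noncomputable def complexifyAdd (f : X →+ Y) : complexifySpace X →+ complexifySpace Y :=
  AddMonoidHom.mk' (complexifyFun f) fun s t => by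
    simp only [complexifyFun, reX_add, imX_add, map_add, mkX_add]

theorem complexifyAdd_apply (f : X →+ Y) (s : complexifySpace X) :
    complexifyAdd f s = mkX (f (reX s)) (f (imX s)) := rfl

theorem complexifyAdd_smul (f : X →+ Y) (hf : ∀ (r : ℝ) (x : X), f (r • x) = r • f x) (c : ℂ)
    (s : complexifySpace X) : complexifyAdd f (c • s) = c • complexifyAdd f s := by
  simp only [complexifyAdd_apply, reX_smul, imX_smul, map_sub, map_add, hf, smul_mkX]

/-- The complexification `x + iy ↦ f x + i f y` of a linear map. -/
noncomputable def complexifyLin (f : X →ₗ[ℝ] Y) : complexifySpace X →ₗ[ℂ] complexifySpace Y where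
  toFun := complexifyAdd f.toAddMonoidHom
  map_add' := (complexifyAdd f.toAddMonoidHom).map_add
  map_smul' := complexifyAdd_smul f.toAddMonoidHom f.map_smul

end Maps

variable {k : OpKind}

/-- The complexification `X + iX` of a real object `X`. -/
noncomputable def OpCat.complexify (A : OpCat.{u} k ℝ ℝ) : OpCat.{u} k ℂ ℂ where
  H := HilbertC A.H
  X := complexifySpace A.X
  one_mem h := ⟨1, A.one_mem h, 0, A.X.zero_mem, combine_one_zero.symm⟩
  star_mem h := by
    rintro _ ⟨x, hx, y, hy, rfl⟩
    exact ⟨_, A.star_mem h x hx, _, A.X.neg_mem (A.star_mem h y hy), star_combine x y⟩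

/-- The complexification `f_c (x + iy) = f x + i f y` of a morphism `f`. -/
noncomputable def OpHom.complexify {A B : OpCat.{u} k ℝ ℝ} (f : OpHom A B) :
    OpHom A.complexify B.complexify where
  hom := complexifyAdd f.hom
  map_smul := complexifyAdd_smul f.hom f.map_smul
  isMorphism := f.isMorphism.complexify

/-- The complexification functor from the real to the complex category (of the given kind). -/
noncomputable def complexification (k : OpKind) : OpCat.{u} k ℝ ℝ ⥤ OpCat.{u} k ℂ ℂ where
  obj A := A.complexify
  map f := OpHom.complexify f
  map_id A := by
    apply OpHom.ext
    ext s : 1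
    exact mkX_eta s
  map_comp f g := by
    apply OpHom.ext
    ext s : 1
    exact complexifyFun_comp g.hom f.hom s

variable {G : Type v} [Group G]

/-- The complexification `X + iX` of a real `G`-object `X`, with `g (x + iy) = gx + i gy`. -/
noncomputable def GOpCat.complexify (A : GOpCat.{u} G k ℝ ℝ) : GOpCat.{u} G k ℂ ℂ where
  toOpCat := A.toOpCat.complexify
  ρ :=
    { toFun := fun g => complexifyLin (A.ρ g)
      map_one' := by
        ext s : 1
        rw [map_one]
        exact mkX_eta s
      map_mul' := fun g h => by
        ext s : 1
        rw [map_mul]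
        exact complexifyFun_comp (A.ρ g) (A.ρ h) s }
  isSymmetry g := (A.isSymmetry g).complexify (f := (A.ρ g).toAddMonoidHom)

/-- The complexification functor from the real to the complex `G`-category
(of the given kind). -/
noncomputable def complexificationG (G : Type v) [Group G] (k : OpKind) :
    GOpCat.{u} G k ℝ ℝ ⥤ GOpCat.{u} G k ℂ ℂ where
  obj A := A.complexify
  map {A B} f := ⟨f.toOpHom.complexify, fun g s =>
    (complexifyFun_comp f.hom (A.ρ g) s).symm.trans <|
      (congrArg (fun F => complexifyFun F s) (funext (f.equivariant g))).trans
        (complexifyFun_comp (B.ρ g) f.hom s)⟩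
  map_id A := by
    apply GOpHom.ext
    ext s : 1
    exact mkX_eta s
  map_comp f g := by
    apply GOpHom.ext
    ext s : 1
    exact complexifyFun_comp g.hom f.hom s

end ComplexifyFunctor

section ForgetfulFunctors

open CategoryTheory

section Maps

variable {H : Type*} [NormedAddCommGroup H] [InnerProductSpace ℂ H]
  {K : Type*} [NormedAddCommGroup K] [InnerProductSpace ℂ K]
  {L : Type*} [NormedAddCommGroup L] [InnerProductSpace ℂ L]
  {X : Submodule ℂ (H →L[ℂ] H)} {Y : Submodule ℂ (K →L[ℂ] K)} {Z : Submodule ℂ (L →L[ℂ] L)}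

theorem realFun_smul (f : X →+ Y) (hf : ∀ (r : ℝ) (x : X), f ((r : ℂ) • x) = (r : ℂ) • f x)
    (r : ℝ) (x : realSpace X) : realFun f (r • x) = r • realFun f x := by
  rw [realFun_apply, realFun_apply, realEquiv_symm_smul, hf, realEquiv_smul]

theorem realFun_id (x : realSpace X) : realFun (AddMonoidHom.id X) x = x :=
  (realEquiv X).apply_symm_apply x

theorem realFun_comp (g : Y →+ Z) (f : X →+ Y) (x : realSpace X) :
    realFun (g.comp f) x = realFun g (realFun f x) := by
  simp only [realFun_apply, AddEquiv.symm_apply_apply, AddMonoidHom.comp_apply]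

/-- A complex linear map, regarded as a real linear map between real spaces. -/
noncomputable def realLin (f : X →ₗ[ℂ] Y) : realSpace X →ₗ[ℝ] realSpace Y where
  toFun := realFun f.toAddMonoidHom
  map_add' := (realFun f.toAddMonoidHom).map_add
  map_smul' := realFun_smul f.toAddMonoidHom fun r x => f.map_smul (r : ℂ) x

end Maps

variable {k : OpKind} {𝔽 : Type} [Field 𝔽] [Algebra 𝔽 ℂ]

/-- A complex object, regarded as a real object: the Hilbert space is regarded as a real Hilbert
space, and the space of operators is regarded as a real space of operators on it. -/
noncomputable def OpCat.toReal (A : OpCat.{u} k ℂ 𝔽) : OpCat.{u} k ℝ ℝ where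
  H := A.H
  innerProd := InnerProductSpace.complexToReal
  X := realSpace A.X
  one_mem h := ⟨1, A.one_mem h, rfl⟩
  star_mem := by
    rintro h _ ⟨x, hx, rfl⟩
    exact ⟨star x, A.star_mem h x hx, star_restrictScalars x⟩

variable [Algebra ℝ 𝔽] [IsScalarTower ℝ 𝔽 ℂ]

/-- A morphism between complex objects, regarded as a morphism between real objects. -/
noncomputable def OpHom.toReal {A B : OpCat.{u} k ℂ 𝔽} (f : OpHom A B) :
    OpHom A.toReal B.toReal where
  hom := (realFun f.hom : realSpace A.X →+ realSpace B.X)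
  map_smul := realFun_smul f.hom fun r x => by
    have h := f.map_smul (algebraMap ℝ 𝔽 r) x
    rw [← IsScalarTower.algebraMap_apply] at h
    exact h
  isMorphism := f.isMorphism.real

/-- The forgetful functor from the complex (`𝔽 = ℂ`) or the intermediate (`𝔽 = ℝ`) category to the
real category (of the given kind). -/
noncomputable def forgetToReal (k : OpKind) (𝔽 : Type) [Field 𝔽] [Algebra 𝔽 ℂ] [Algebra ℝ 𝔽]
    [IsScalarTower ℝ 𝔽 ℂ] : OpCat.{u} k ℂ 𝔽 ⥤ OpCat.{u} k ℝ ℝ where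
  obj A := A.toReal
  map f := OpHom.toReal f
  map_id A := by
    apply OpHom.ext
    ext x : 1
    exact realFun_id (X := A.X) x
  map_comp {A B C} f g := by
    apply OpHom.ext
    ext x : 1
    exact realFun_comp (X := A.X) (Y := B.X) (Z := C.X) g.hom f.hom x

/-- The complexification functor from the intermediate to the complex category (of the given
kind): a complex space is regarded as a real space, and then complexified. -/
noncomputable def intermediateComplexification (k : OpKind) :
    OpCat.{u} k ℂ ℝ ⥤ OpCat.{u} k ℂ ℂ :=
  forgetToReal k ℝ ⋙ complexification k

variable {G : Type v} [Group G]

/-- A complex `G`-object, regarded as a real `G`-object. -/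
noncomputable def GOpCat.toReal (A : GOpCat.{u} G k ℂ 𝔽) : GOpCat.{u} G k ℝ ℝ where
  toOpCat := A.toOpCat.toReal
  ρ :=
    { toFun := fun g => (realLin (A.ρ g) : realSpace A.X →ₗ[ℝ] realSpace A.X)
      map_one' := by
        ext x : 1
        rw [map_one]
        exact realFun_id (X := A.X) x
      map_mul' := fun g h => by
        ext x : 1
        rw [map_mul]
        exact realFun_comp (X := A.X) (Y := A.X) (Z := A.X) (A.ρ g).toAddMonoidHom
          (A.ρ h).toAddMonoidHom x }
  isSymmetry g := (A.isSymmetry g).real (f := (A.ρ g).toAddMonoidHom)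

/-- The forgetful functor from the complex (`𝔽 = ℂ`) or the intermediate (`𝔽 = ℝ`) `G`-category to
the real `G`-category (of the given kind). -/
noncomputable def forgetToRealG (G : Type v) [Group G] (k : OpKind) (𝔽 : Type) [Field 𝔽]
    [Algebra 𝔽 ℂ] [Algebra ℝ 𝔽] [IsScalarTower ℝ 𝔽 ℂ] :
    GOpCat.{u} G k ℂ 𝔽 ⥤ GOpCat.{u} G k ℝ ℝ where
  obj A := A.toReal
  map {A B} f := ⟨f.toOpHom.toReal, fun g x =>
    (realFun_comp (X := A.X) (Y := A.X) (Z := B.X) f.hom (A.ρ g).toAddMonoidHom x).symm.trans <|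
      (congrArg (realEquiv B.X) (f.equivariant g _)).trans
        (realFun_comp (X := A.X) (Y := B.X) (Z := B.X) (B.ρ g).toAddMonoidHom f.hom x)⟩
  map_id A := by
    apply GOpHom.ext
    ext x : 1
    exact realFun_id (X := A.X) x
  map_comp {A B C} f g := by
    apply GOpHom.ext
    ext x : 1
    exact realFun_comp (X := A.X) (Y := B.X) (Z := C.X) g.hom f.hom x

/-- The complexification functor from the intermediate to the complex `G`-category (of the given
kind): a complex space is regarded as a real space, and then complexified. -/
noncomputable def intermediateComplexificationG (G : Type v) [Group G] (k : OpKind) :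
    GOpCat.{u} G k ℂ ℝ ⥤ GOpCat.{u} G k ℂ ℂ :=
  forgetToRealG G k ℝ ⋙ complexificationG G k

section Unit

variable {𝔽₁ 𝔽₂ : Type} [RCLike 𝔽₁] [Field 𝔽₂] [Algebra 𝔽₂ 𝔽₁]

/-- A unital operator space, regarded as an operator space. -/
def OpCat.toSpace (A : OpCat.{u} .unital 𝔽₁ 𝔽₂) : OpCat.{u} .space 𝔽₁ 𝔽₂ where
  H := A.H
  X := A.X
  one_mem h := absurd rfl h
  star_mem := nofun

/-- A unital completely contractive map, regarded as a completely contractive map. -/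
def OpHom.toSpace {A B : OpCat.{u} .unital 𝔽₁ 𝔽₂} (f : OpHom A B) :
    OpHom A.toSpace B.toSpace where
  hom := (f.hom : A.X →+ B.X)
  map_smul := f.map_smul
  isMorphism := f.isMorphism.2

/-- A unital `G`-operator space, regarded as a `G`-operator space. -/
def GOpCat.toSpace {G : Type v} [Group G] (A : GOpCat.{u} G .unital 𝔽₁ 𝔽₂) :
    GOpCat.{u} G .space 𝔽₁ 𝔽₂ where
  toOpCat := A.toOpCat.toSpace
  ρ := (A.ρ : Representation 𝔽₁ G A.X)
  isSymmetry g := (A.isSymmetry g).2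

variable (𝔽₁ 𝔽₂)

/-- The forgetful functor from unital operator spaces to operator spaces. -/
def forgetUnit : OpCat.{u} .unital 𝔽₁ 𝔽₂ ⥤ OpCat.{u} .space 𝔽₁ 𝔽₂ where
  obj A := A.toSpace
  map f := OpHom.toSpace f
  map_id _ := rfl
  map_comp _ _ := rfl

/-- The forgetful functor from unital `G`-operator spaces to `G`-operator spaces. -/
def forgetUnitG (G : Type v) [Group G] :
    GOpCat.{u} G .unital 𝔽₁ 𝔽₂ ⥤ GOpCat.{u} G .space 𝔽₁ 𝔽₂ where
  obj A := A.toSpace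
  map f := ⟨OpHom.toSpace f.toOpHom, f.equivariant⟩
  map_id _ := rfl
  map_comp _ _ := rfl

end Unit

end ForgetfulFunctors

section Quaternions

open scoped Quaternion

/-- Left multiplication by a quaternion, on the real Hilbert space of quaternions (regarded as a
direct sum with one summand, in order to have one such space in each universe). -/
noncomputable def quaternionOp :
    ℍ[ℝ] →ₗ[ℝ] (PiLp 2 (fun _ : PUnit.{u + 1} => ℍ[ℝ]) →L[ℝ]
      PiLp 2 (fun _ : PUnit.{u + 1} => ℍ[ℝ])) where
  toFun a := blockOp (Matrix.of fun _ _ => ContinuousLinearMap.mul ℝ ℍ[ℝ] a)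
  map_add' a b := by
    ext v i : 2
    rw [add_apply, PiLp.add_apply, blockOp_apply, blockOp_apply, blockOp_apply]
    simp
  map_smul' r a := by
    ext v i : 2
    rw [smul_apply, PiLp.smul_apply, blockOp_apply, blockOp_apply]
    simp

theorem quaternionOp_apply (a : ℍ[ℝ]) (v : PiLp 2 (fun _ : PUnit.{u + 1} => ℍ[ℝ]))
    (i : PUnit.{u + 1}) : quaternionOp a v i = a * v i := by
  change blockOp _ v i = _
  rw [blockOp_apply]
  simp

/-- The algebra of quaternions, as a real operator system (and so as a real unital operator space
and as a real operator space), acting on itself by left multiplication. -/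
noncomputable def quaternionSpace (k : OpKind) : OpCat.{u} k ℝ ℝ where
  H := PiLp 2 (fun _ : PUnit.{u + 1} => ℍ[ℝ])
  X := LinearMap.range quaternionOp
  one_mem _ := ⟨1, by ext v i : 2; simp [quaternionOp_apply]⟩
  star_mem := by
    rintro - _ ⟨a, rfl⟩
    refine ⟨star a, ?_⟩
    rw [ContinuousLinearMap.star_eq_adjoint, ContinuousLinearMap.eq_adjoint_iff]
    intro v w
    simp only [PiLp.inner_apply, quaternionOp_apply, Quaternion.inner_def]
    simp [Quaternion.re_mul]
    ring

end Quaternions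

end OpSp

/-!
For a complex space `X`, the map `x + iy ↦ x + i • y` is a morphism from the complexification of `X`
as a real space to `X`. If `X` is itself a complexification, it is not the complexification of a
real map, so that `F_c` is not full.

A complexification carries a conjugation `x + iy ↦ x - iy`, which is a morphism of the given kind up
to conjugate-linearity, and isomorphisms transport it. Complex spaces without such a conjugation are
therefore not in the essential image of `F_c`. For (unital) operator spaces, take the span of `1`
and of a normal operator with four eigenvalues: a conjugation would permute the points where the
norm of an element is attained, that is the eigenvalues, and conjugate their cross-ratio, which no
permutation of them does. For operator systems, take the affine functions on an octahedron without
affine symmetries: the order forces the conjugation to be that of the coefficients. This acts as a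
transposition on an additional block of Pauli matrices, so that it is not completely positive.

If `J` is the isometry of `ℍ` which corresponds to multiplication by `i` on a complex space, then
conjugating `2 × 2` matrices by `diag(1, i)` shows that `[1, b; c, d]` and `[1, -Jb; Jc, d]` have
the same norm. For unit quaternions, the norm of `[1, b; c, d]` is `2` exactly if `d = c b`, so that
`(J c) (J b) = -c b`, which noncommutativity excludes.

In a unital operator space, a row `[1, b]` has norm greater than `1` unless `b = 0`. In a column
Hilbert space of dimension at least two, every `c` of norm at most `1` is part of a row `[c, d]` of
norm at most `1` with `d ≠ 0`, namely for any unit vector `d` orthogonal to `c`.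
-/

namespace OpSp

open scoped InnerProductSpace
open CategoryTheory

section Matrices

variable {𝔽 : Type*} [RCLike 𝔽]
variable {H : Type*} [NormedAddCommGroup H] [InnerProductSpace 𝔽 H]
variable {K : Type*} [NormedAddCommGroup K] [InnerProductSpace 𝔽 K]
variable {X : Submodule 𝔽 (H →L[𝔽] H)} {Y : Submodule 𝔽 (K →L[𝔽] K)}

theorem matOp_one_by_one (x : X) :
    ‖matOp (Matrix.of fun _ _ : Fin 1 => x)‖ = ‖(x : H →L[𝔽] H)‖ ∧
      (MatPos (Matrix.of fun _ _ : Fin 1 => x) ↔ (x : H →L[𝔽] H).IsPositive) := by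
  have eval_surjective : Function.Surjective fun v : PiLp 2 (fun _ : Fin 1 => H) => v 0 :=
    fun w => ⟨WithLp.toLp 2 fun _ => w, rfl⟩
  have eval_intertwines (v : PiLp 2 (fun _ : Fin 1 => H)) :
      matOp (Matrix.of fun _ _ : Fin 1 => x) v 0 = (x : H →L[𝔽] H) (v 0) := by
    simp [matOp_apply]
  exact ⟨opNorm_eq_of_intertwine _ _ _ eval_surjective
      (fun v => by simp [PiLp.norm_eq_of_L2]) eval_intertwines,
    isPositive_iff_of_intertwine _ _ _ eval_surjective
      (fun v w => by simp [PiLp.inner_apply]) eval_intertwines⟩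

theorem CompletelyContractive.norm_le {f : X → Y} (hf : CompletelyContractive f) (x : X) :
    ‖(f x : K →L[𝔽] K)‖ ≤ ‖(x : H →L[𝔽] H)‖ := by
  rw [← (matOp_one_by_one x).1, ← (matOp_one_by_one (f x)).1]
  exact hf 1 _

theorem CompletelyPositive.isPositive {f : X → Y} (hf : CompletelyPositive f) {x : X}
    (hx : (x : H →L[𝔽] H).IsPositive) : (f x : K →L[𝔽] K).IsPositive :=
  (matOp_one_by_one (f x)).2.1 (hf 1 _ ((matOp_one_by_one x).2.2 hx))

section Intertwine

/-- The amplification `V ⊕ ⋯ ⊕ V : Kⁿ → Hⁿ` of an isometry `V : K → H`. -/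
noncomputable def amplify (V : K →ₗᵢ[𝔽] H) (ι : Type*) [Fintype ι] :
    PiLp 2 (fun _ : ι => K) →ₗᵢ[𝔽] PiLp 2 (fun _ : ι => H) where
  toFun w := WithLp.toLp 2 fun i => V (w i)
  map_add' v w := by ext i; simp
  map_smul' c w := by ext i; simp
  norm_map' w := by simp [PiLp.norm_eq_of_L2]

theorem amplify_matOp {f : X → Y} {V : K →ₗᵢ[𝔽] H}
    (h : ∀ x w, V ((f x : K →L[𝔽] K) w) = (x : H →L[𝔽] H) (V w)) {ι : Type*} [Fintype ι]
    (x : Matrix ι ι X) (w : PiLp 2 (fun _ : ι => K)) :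
    amplify V ι (matOp (x.map f) w) = matOp x (amplify V ι w) := by
  ext i
  simp [amplify, matOp_apply, h]

theorem CompletelyContractive.of_intertwine {f : X → Y} {V : K →ₗᵢ[𝔽] H}
    (h : ∀ x w, V ((f x : K →L[𝔽] K) w) = (x : H →L[𝔽] H) (V w)) : CompletelyContractive f := by
  intro n x
  refine ContinuousLinearMap.opNorm_le_bound _ (norm_nonneg _) fun w => ?_
  rw [← (amplify V (Fin n)).norm_map, amplify_matOp h, ← (amplify V (Fin n)).norm_map w]
  exact (matOp x).le_opNorm _

theorem CompletelyPositive.of_intertwine {f : X → Y} {V : K →ₗᵢ[𝔽] H}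
    (h : ∀ x w, V ((f x : K →L[𝔽] K) w) = (x : H →L[𝔽] H) (V w)) : CompletelyPositive f := by
  intro n x hx
  refine (isPositive_iff_re _).2 ⟨fun v w => ?_, fun v => ?_⟩
  · rw [← (amplify V (Fin n)).inner_map_map, ← (amplify V (Fin n)).inner_map_map v,
      amplify_matOp h, amplify_matOp h, ((isPositive_iff_re _).1 hx).1]
  · rw [← (amplify V (Fin n)).inner_map_map, amplify_matOp h]
    exact hx.2 _

theorem PreservesOne.of_intertwine {f : X → Y} {V : K →ₗᵢ[𝔽] H}
    (h : ∀ x w, V ((f x : K →L[𝔽] K) w) = (x : H →L[𝔽] H) (V w)) : PreservesOne f := by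
  intro x hx
  ext w
  apply V.injective
  rw [h, hx, one_apply_eq_self, one_apply_eq_self]

theorem IsMorphism.of_intertwine (k : OpKind) {f : X → Y} {V : K →ₗᵢ[𝔽] H}
    (h : ∀ x w, V ((f x : K →L[𝔽] K) w) = (x : H →L[𝔽] H) (V w)) : IsMorphism k f :=
  match k with
  | .space => CompletelyContractive.of_intertwine h
  | .unital => ⟨.of_intertwine h, .of_intertwine h⟩
  | .system => ⟨.of_intertwine h, .of_intertwine h⟩

end Intertwine

section TwoByTwoTrick

variable {ι : Type*} [Fintype ι]

/-- The vector of `Eⁿ ⊕ Eⁿ` with components `a` and `b`. -/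
def sumVec {E ι : Type*} (a b : PiLp 2 (fun _ : ι => E)) : PiLp 2 (fun _ : ι ⊕ ι => E) :=
  WithLp.toLp 2 (Sum.elim a b)

theorem exists_eq_sumVec {E ι : Type*} (v : PiLp 2 (fun _ : ι ⊕ ι => E)) :
    ∃ a b, v = sumVec a b :=
  ⟨WithLp.toLp 2 fun i => v (Sum.inl i), WithLp.toLp 2 fun i => v (Sum.inr i), by
    ext (i | i) <;> rfl⟩

theorem matOp_fromBlocks_sumVec (p x y q : Matrix ι ι X) (a b : PiLp 2 (fun _ : ι => H)) :
    matOp (Matrix.fromBlocks p x y q) (sumVec a b) =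
      sumVec (matOp p a + matOp x b) (matOp y a + matOp q b) := by
  ext (i | i) <;> simp [matOp_apply, sumVec]

theorem inner_sumVec (a b c d : PiLp 2 (fun _ : ι => H)) :
    ⟪sumVec a b, sumVec c d⟫_𝔽 = ⟪a, c⟫_𝔽 + ⟪b, d⟫_𝔽 := by
  simp [PiLp.inner_apply, sumVec]

variable [DecidableEq ι]

theorem matOp_diagonal_of_eq_smul_one {t : ℝ} {e : X} (he : (e : H →L[𝔽] H) = (t : 𝔽) • 1)
    (w : PiLp 2 (fun _ : ι => H)) : matOp (Matrix.diagonal fun _ : ι => e) w = (t : 𝔽) • w := by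
  ext i
  rw [matOp_apply, Finset.sum_eq_single i (fun j _ hj => by simp [Matrix.diagonal_apply_ne' _ hj])
    (by simp)]
  simp [he]

theorem inner_matOp_fromBlocks {t : ℝ} {e : X} (he : (e : H →L[𝔽] H) = (t : 𝔽) • 1)
    (x y : Matrix ι ι X) (a b c d : PiLp 2 (fun _ : ι => H)) :
    ⟪matOp (Matrix.fromBlocks (Matrix.diagonal fun _ => e) x y (Matrix.diagonal fun _ => e))
      (sumVec a b), sumVec c d⟫_𝔽 =
    t * ⟪a, c⟫_𝔽 + ⟪matOp x b, c⟫_𝔽 + ⟪matOp y a, d⟫_𝔽 + t * ⟪b, d⟫_𝔽 := by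
  simp only [matOp_fromBlocks_sumVec, inner_sumVec, matOp_diagonal_of_eq_smul_one he,
    inner_add_left, inner_smul_left, RCLike.conj_ofReal]
  ring

theorem norm_matOp_le_of_matPos {t : ℝ} (ht : 0 ≤ t) {e : X}
    (he : (e : H →L[𝔽] H) = (t : 𝔽) • 1) (x y : Matrix ι ι X)
    (h : MatPos (Matrix.fromBlocks (Matrix.diagonal fun _ => e) x y
      (Matrix.diagonal fun _ => e))) : ‖matOp x‖ ≤ t := by
  have adjoint (a b) : ⟪matOp y a, b⟫_𝔽 = ⟪a, matOp x b⟫_𝔽 := by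
    have h := h.1 (sumVec a 0) (sumVec 0 b)
    rw [ContinuousLinearMap.coe_coe, inner_matOp_fromBlocks he,
      ← inner_conj_symm (sumVec a 0), inner_matOp_fromBlocks he] at h
    simpa using h
  refine ContinuousLinearMap.opNorm_le_bound _ ht fun b => ?_
  set p := matOp x b with hp
  have quadratic (s : ℝ) : 0 ≤ t * (s ^ 2 * ‖p‖ ^ 2) - 2 * s * ‖p‖ ^ 2 + t * ‖b‖ ^ 2 := by
    have h := h.2 (sumVec (-(s : 𝔽) • p) b)
    rw [ContinuousLinearMap.reApplyInnerSelf_apply, inner_matOp_fromBlocks he, adjoint,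
      ← hp] at h
    simp only [map_add, inner_smul_left, inner_smul_right, inner_self_eq_norm_sq_to_K, map_neg,
      RCLike.conj_ofReal] at h
    norm_cast at h
    rw [norm_smul, RCLike.norm_ofReal, mul_pow, sq_abs] at h
    linarith
  rcases ht.eq_or_lt with rfl | ht
  · have := quadratic 1
    have : ‖p‖ = 0 := by nlinarith [norm_nonneg p]
    simp [this]
  · have : 0 ≤ t * (t * (t⁻¹ ^ 2 * ‖p‖ ^ 2) - 2 * t⁻¹ * ‖p‖ ^ 2 + t * ‖b‖ ^ 2) :=
      mul_nonneg ht.le (quadratic t⁻¹)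
    refine le_of_sq_le_sq ?_ (by positivity)
    field_simp at this
    linarith

theorem matPos_of_norm_matOp_le [CompleteSpace H] {t : ℝ} {e : X}
    (he : (e : H →L[𝔽] H) = (t : 𝔽) • 1) (x y : Matrix ι ι X)
    (hy : ∀ i j, (y i j : H →L[𝔽] H) = star (x j i : H →L[𝔽] H)) (h : ‖matOp x‖ ≤ t) :
    MatPos (Matrix.fromBlocks (Matrix.diagonal fun _ => e) x y
      (Matrix.diagonal fun _ => e)) := by
  have adjoint (a b) : ⟪matOp y a, b⟫_𝔽 = ⟪a, matOp x b⟫_𝔽 := by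
    simp only [PiLp.inner_apply, matOp_apply, sum_inner, inner_sum, hy,
      ContinuousLinearMap.star_eq_adjoint, ContinuousLinearMap.adjoint_inner_left]
    exact Finset.sum_comm
  have adjoint' (a b) : ⟪matOp x b, a⟫_𝔽 = ⟪b, matOp y a⟫_𝔽 := by
    rw [← inner_conj_symm, ← adjoint, inner_conj_symm]
  refine ⟨fun v w => ?_, fun v => ?_⟩
  · obtain ⟨a, b, rfl⟩ := exists_eq_sumVec v
    obtain ⟨c, d, rfl⟩ := exists_eq_sumVec w
    rw [ContinuousLinearMap.coe_coe, inner_matOp_fromBlocks he,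
      ← inner_conj_symm (sumVec a b), inner_matOp_fromBlocks he, adjoint, adjoint']
    simp only [map_add, map_mul, inner_conj_symm, RCLike.conj_ofReal]
    ring
  · obtain ⟨a, b, rfl⟩ := exists_eq_sumVec v
    rw [ContinuousLinearMap.reApplyInnerSelf_apply, inner_matOp_fromBlocks he, adjoint]
    have off_diagonal : |RCLike.re ⟪matOp x b, a⟫_𝔽| ≤ t * ‖b‖ * ‖a‖ :=
      (RCLike.abs_re_le_norm _).trans <| (norm_inner_le_norm _ _).trans <| by
        gcongr; exact (matOp x).le_of_opNorm_le h b
    have ht : 0 ≤ t := (norm_nonneg _).trans h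
    simp only [map_add, inner_self_eq_norm_sq_to_K, inner_re_symm a (matOp x b)]
    norm_cast
    nlinarith [neg_abs_le (RCLike.re ⟪matOp x b, a⟫_𝔽), mul_nonneg ht (sq_nonneg (‖a‖ - ‖b‖))]

end TwoByTwoTrick

theorem CompletelyPositive.completelyContractive [CompleteSpace H] (one_mem : (1 : H →L[𝔽] H) ∈ X)
    (star_mem : ∀ x ∈ X, star x ∈ X) (f : X →+ Y)
    (map_smul : ∀ (r : ℝ) (x : X), f ((r : 𝔽) • x) = (r : 𝔽) • f x) (map_one : PreservesOne f)
    (hf : CompletelyPositive f) : CompletelyContractive f := by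
  intro n x
  let e : X := ((‖matOp x‖ : ℝ) : 𝔽) • ⟨1, one_mem⟩
  let y : Matrix (Fin n) (Fin n) X := Matrix.of fun i j => ⟨star (x j i : H →L[𝔽] H),
    star_mem _ (x j i).2⟩
  have pos := matPos_of_norm_matOp_le (e := e) rfl x y (fun _ _ => rfl) le_rfl
  rw [← (matOp_reindex finSumFinEquiv.symm _).2] at pos
  have map_pos := hf _ _ pos
  rw [← Matrix.submatrix_map, (matOp_reindex finSumFinEquiv.symm _).2, Matrix.fromBlocks_map,
    Matrix.diagonal_map (map_zero f)] at map_pos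
  refine norm_matOp_le_of_matPos (norm_nonneg _) (e := f e) ?_ (x.map f) (y.map f) map_pos
  rw [map_smul, Submodule.coe_smul, map_one _ rfl]

end Matrices

section Conjugation

variable {H : Type*} [NormedAddCommGroup H]

/-- The conjugation `v + iw ↦ v - iw` of the complexification of a Hilbert space. -/
def HilbertC.conj : HilbertC H →+ HilbertC H where
  toFun v := ⟨v.re, -v.im⟩
  map_zero' := by ext <;> simp
  map_add' v w := by ext <;> simp [add_comm]

@[simp] theorem HilbertC.re_conj (v : HilbertC H) : (HilbertC.conj v).re = v.re := rfl

@[simp] theorem HilbertC.im_conj (v : HilbertC H) : (HilbertC.conj v).im = -v.im := rfl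

theorem HilbertC.conj_conj (v : HilbertC H) : HilbertC.conj (HilbertC.conj v) = v := by
  ext <;> simp

variable [InnerProductSpace ℝ H] {X : Submodule ℝ (H →L[ℝ] H)}

/-- The conjugation `x + iy ↦ x - iy` of the complexification of a space of operators. -/
noncomputable def conjX : complexifySpace X →ₛₗ[starRingEnd ℂ] complexifySpace X where
  toFun s := mkX (reX s) (-imX s)
  map_add' s t := by simp [reX_add, imX_add, mkX_add, add_comm]
  map_smul' c s := by
    simp only [reX_smul, imX_smul, smul_mkX, Complex.conj_re, Complex.conj_im]
    congr 1 <;> module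

theorem conjX_involutive : Function.Involutive (conjX (X := X)) := fun s => by simp [conjX]

theorem conj_apply (s : complexifySpace X) (v : HilbertC H) :
    HilbertC.conj ((s : HilbertC H →L[ℂ] HilbertC H) v) =
      (conjX s : HilbertC H →L[ℂ] HilbertC H) (HilbertC.conj v) := by
  rw [coe_eq_combine s, coe_eq_combine (conjX s)]
  ext <;> simp [conjX, add_comm]

theorem matOp_conjX {ι : Type*} [Fintype ι] (s : Matrix ι ι (complexifySpace X)) :
    ‖matOp s‖ = ‖matOp (s.map conjX)‖ ∧ (MatPos s ↔ MatPos (s.map conjX)) := by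
  let U : PiLp 2 (fun _ : ι => HilbertC H) → PiLp 2 (fun _ : ι => HilbertC H) :=
    fun v => WithLp.toLp 2 fun i => HilbertC.conj (v i)
  refine matOp_compare s (s.map conjX) U (fun w => ⟨U w, ?_⟩) (fun v w => ?_) (fun v => ?_)
  · ext i : 1
    simp [U, HilbertC.conj_conj]
  · simp [U, HilbertC.inner_re]
  · ext i : 1
    simp [U, matOp_apply, conj_apply]

theorem PreservesOne.conjX : PreservesOne (conjX (X := X)) := by
  intro s hs
  rw [coe_eq_combine, combine_eq_one_iff] at hs
  exact (combine_eq_one_iff _ _).2 ⟨by simpa using hs.1, by simpa using hs.2⟩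

theorem IsMorphism.conjX (k : OpKind) : IsMorphism k (conjX (X := X)) :=
  have contractive : CompletelyContractive (OpSp.conjX (X := X)) :=
    fun _ s => (matOp_conjX s).1.ge
  match k with
  | .space => contractive
  | .unital => ⟨.conjX, contractive⟩
  | .system => ⟨.conjX, fun _ s => (matOp_conjX s).2.1⟩

end Conjugation

section Isomorphisms

variable {k : OpKind} {𝔽₁ 𝔽₂ : Type} [RCLike 𝔽₁] [Field 𝔽₂] [Algebra 𝔽₂ 𝔽₁]

theorem iso_inv_hom_apply {A B : OpCat.{u} k 𝔽₁ 𝔽₂} (φ : A ≅ B) (x : A.X) :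
    OpHom.hom φ.inv (OpHom.hom φ.hom x) = x :=
  DFunLike.congr_fun (congrArg OpHom.hom φ.hom_inv_id) x

theorem iso_hom_inv_apply {A B : OpCat.{u} k 𝔽₁ 𝔽₂} (φ : A ≅ B) (y : B.X) :
    OpHom.hom φ.hom (OpHom.hom φ.inv y) = y :=
  DFunLike.congr_fun (congrArg OpHom.hom φ.inv_hom_id) y

theorem OpHom.completelyContractive [Algebra ℝ 𝔽₂] (algebraMap_real : ∀ r : ℝ,
    algebraMap 𝔽₂ 𝔽₁ (algebraMap ℝ 𝔽₂ r) = (r : 𝔽₁)) {A B : OpCat.{u} k 𝔽₁ 𝔽₂} (f : OpHom A B) :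
    CompletelyContractive f.hom := by
  obtain ⟨f, map_smul, hf⟩ := f
  cases k with
  | space => exact hf
  | unital => exact hf.2
  | system =>
    refine CompletelyPositive.completelyContractive (A.one_mem nofun) (A.star_mem rfl) f
      (fun r x => ?_) hf.1 hf.2
    simpa only [algebraMap_real] using map_smul (algebraMap ℝ 𝔽₂ r) x

end Isomorphisms

section ForgetAction

variable (G : Type v) [Group G]

/-- The functor forgetting the action of `G`. -/
def forgetAction (k : OpKind) (𝔽₁ 𝔽₂ : Type) [RCLike 𝔽₁] [Field 𝔽₂] [Algebra 𝔽₂ 𝔽₁] :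
    GOpCat.{u} G k 𝔽₁ 𝔽₂ ⥤ OpCat.{u} k 𝔽₁ 𝔽₂ where
  obj A := A.toOpCat
  map f := GOpHom.toOpHom f

instance (k : OpKind) (𝔽₁ 𝔽₂ : Type) [RCLike 𝔽₁] [Field 𝔽₂] [Algebra 𝔽₂ 𝔽₁] :
    (forgetAction.{u} G k 𝔽₁ 𝔽₂).Faithful where
  map_injective h := GOpHom.ext (congrArg OpHom.hom h)

variable {G} {k l : OpKind} {𝔽₁ 𝔽₂ 𝔽₃ 𝔽₄ : Type} [RCLike 𝔽₁] [Field 𝔽₂] [Algebra 𝔽₂ 𝔽₁]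
  [RCLike 𝔽₃] [Field 𝔽₄] [Algebra 𝔽₄ 𝔽₃]
  {F : OpCat.{u} k 𝔽₁ 𝔽₂ ⥤ OpCat.{u} l 𝔽₃ 𝔽₄} {F' : GOpCat.{u} G k 𝔽₁ 𝔽₂ ⥤ GOpCat.{u} G l 𝔽₃ 𝔽₄}

theorem faithful_of_forgetAction [F.Faithful]
    (e : F' ⋙ forgetAction G l 𝔽₃ 𝔽₄ ≅ forgetAction G k 𝔽₁ 𝔽₂ ⋙ F) : F'.Faithful :=
  Functor.Faithful.of_comp_iso e

theorem essSurj_of_forgetAction [F'.EssSurj]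
    (e : F' ⋙ forgetAction G l 𝔽₃ 𝔽₄ ≅ forgetAction G k 𝔽₁ 𝔽₂ ⋙ F) : F.EssSurj where
  mem_essImage B := ⟨_, ⟨(e.app _).symm ≪≫
    (forgetAction G l 𝔽₃ 𝔽₄).mapIso (F'.objObjPreimageIso (B.trivialAction G))⟩⟩

end ForgetAction

section Faithful

theorem complexifyAdd_injective {H K : Type*} [NormedAddCommGroup H] [InnerProductSpace ℝ H]
    [NormedAddCommGroup K] [InnerProductSpace ℝ K] {X : Submodule ℝ (H →L[ℝ] H)}
    {Y : Submodule ℝ (K →L[ℝ] K)} : Function.Injective (complexifyAdd (X := X) (Y := Y)) := by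
  intro f g h
  ext x : 1
  simpa [complexifyAdd_apply] using congrArg reX (DFunLike.congr_fun h (mkX x 0))

theorem realFun_injective {H K : Type*} [NormedAddCommGroup H] [InnerProductSpace ℂ H]
    [NormedAddCommGroup K] [InnerProductSpace ℂ K] {X : Submodule ℂ (H →L[ℂ] H)}
    {Y : Submodule ℂ (K →L[ℂ] K)} : Function.Injective (realFun (X := X) (Y := Y)) := by
  intro f g h
  ext x : 1
  simpa [realFun_apply] using DFunLike.congr_fun h (realEquiv X x)

instance (k : OpKind) : (complexification.{u} k).Faithful where
  map_injective h := OpHom.ext (complexifyAdd_injective (congrArg OpHom.hom h))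

instance (k : OpKind) (𝔽 : Type) [Field 𝔽] [Algebra 𝔽 ℂ] [Algebra ℝ 𝔽] [IsScalarTower ℝ 𝔽 ℂ] :
    (forgetToReal.{u} k 𝔽).Faithful where
  map_injective h := OpHom.ext (realFun_injective (congrArg OpHom.hom h))

instance (k : OpKind) : (intermediateComplexification.{u} k).Faithful :=
  inferInstanceAs (forgetToReal.{u} k ℝ ⋙ complexification k).Faithful

instance (G : Type v) [Group G] (k : OpKind) : (complexificationG.{u} G k).Faithful :=
  faithful_of_forgetAction (F := complexification k) (Iso.refl _)

instance (G : Type v) [Group G] (k : OpKind) : (intermediateComplexificationG.{u} G k).Faithful :=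
  faithful_of_forgetAction (F := intermediateComplexification k) (Iso.refl _)

end Faithful

section NotFull

attribute [local instance] InnerProductSpace.complexToReal

section Counit

variable {H : Type*} [NormedAddCommGroup H] [InnerProductSpace ℂ H]
variable {X : Submodule ℂ (H →L[ℂ] H)}

theorem realSpace_apply_smul (x : realSpace X) (c : ℂ) (v : H) :
    (x : H →L[ℝ] H) (c • v) = c • (x : H →L[ℝ] H) v := by
  simp only [← realEquiv_symm_coe_apply, map_smul]

/-- The map `x + iy ↦ x + i • y` onto `X` of the complexification of `X`, regarded as a real
space: the counit of complexification. -/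
noncomputable def complexifyCounit (X : Submodule ℂ (H →L[ℂ] H)) :
    complexifySpace (realSpace X) →ₗ[ℂ] X where
  toFun s := (realEquiv X).symm (reX s) + Complex.I • (realEquiv X).symm (imX s)
  map_add' s t := by
    ext w
    simp only [reX_add, imX_add, Submodule.coe_add, Submodule.coe_smul, add_apply,
      smul_apply, realEquiv_symm_coe_apply]
    module
  map_smul' c s := by
    ext w
    simp only [reX_smul, imX_smul, Submodule.coe_add, Submodule.coe_sub, Submodule.coe_smul,
      add_apply, sub_apply, smul_apply,
      realEquiv_symm_coe_apply, RingHom.id_apply, ← Complex.coe_smul]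
    match_scalars
    · linear_combination Complex.re_add_im c
    · linear_combination Complex.I * Complex.re_add_im c - (c.im : ℂ) * Complex.I_mul_I

theorem complexifyCounit_apply (s : complexifySpace (realSpace X)) (w : H) :
    (complexifyCounit X s : H →L[ℂ] H) w =
      (reX s : H →L[ℝ] H) w + Complex.I • (imX s : H →L[ℝ] H) w := by
  simp only [complexifyCounit, LinearMap.coe_mk, AddHom.coe_mk, Submodule.coe_add,
    Submodule.coe_smul, add_apply, smul_apply,
    realEquiv_symm_coe_apply]

theorem complexifyCounit_mkX_zero (x : X) : complexifyCounit X (mkX (realEquiv X x) 0) = x := by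
  ext w
  simp [complexifyCounit_apply, realEquiv_coe_apply]

/-- The isometry `v ↦ (v - i(iv)) / √2`, whose range is the eigenspace of the operator `i` on `H`
for the eigenvalue `i` of its extension to `H + iH`. -/
noncomputable def eigenIsometry (H : Type*) [NormedAddCommGroup H] [InnerProductSpace ℂ H] :
    H →ₗᵢ[ℂ] HilbertC H where
  toFun v := (√2 : ℂ)⁻¹ • ⟨v, -Complex.I • v⟩
  map_add' v w := by
    rw [← smul_add]
    refine congrArg _ (HilbertC.ext rfl ?_)
    simp
  map_smul' c v := by
    rw [RingHom.id_apply, smul_comm c]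
    refine congrArg _ (HilbertC.ext ?_ ?_)
    · simp only [HilbertC.re_smul, ← Complex.coe_smul]
      nth_rw 1 [← Complex.re_add_im c]
      module
    · simp only [HilbertC.im_smul, ← Complex.coe_smul]
      nth_rw 1 [← Complex.re_add_im c]
      match_scalars
      linear_combination (-c.im : ℂ) * Complex.I_mul_I
  norm_map' v := by
    refine (sq_eq_sq₀ (norm_nonneg _) (norm_nonneg _)).1 ?_
    simp [norm_smul, mul_pow, HilbertC.norm_sq]
    ring

theorem eigenIsometry_complexifyCounit (s : complexifySpace (realSpace X)) (w : H) :
    eigenIsometry H ((complexifyCounit X s : H →L[ℂ] H) w) =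
      (s : HilbertC H →L[ℂ] HilbertC H) (eigenIsometry H w) := by
  change (√2 : ℂ)⁻¹ • _ = (s : HilbertC H →L[ℂ] HilbertC H) ((√2 : ℂ)⁻¹ • _)
  rw [map_smul, coe_eq_combine]
  refine congrArg _ (HilbertC.ext ?_ ?_)
  · simp [complexifyCounit_apply, realSpace_apply_smul]
  · simp [complexifyCounit_apply, realSpace_apply_smul, smul_smul]

theorem IsMorphism.complexifyCounit (k : OpKind) : IsMorphism k (complexifyCounit X) :=
  .of_intertwine k eigenIsometry_complexifyCounit

end Counit

/-- The space of all bounded operators on a Hilbert space, as an object of each kind. -/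
def OpCat.full (k : OpKind) (𝔽₁ 𝔽₂ : Type) [RCLike 𝔽₁] (H : Type u) [NormedAddCommGroup H]
    [InnerProductSpace 𝔽₁ H] [CompleteSpace H] : OpCat.{u} k 𝔽₁ 𝔽₂ where
  H := H
  X := ⊤
  one_mem _ := Submodule.mem_top
  star_mem _ _ _ := Submodule.mem_top

instance (k : OpKind) (𝔽₁ 𝔽₂ : Type) [RCLike 𝔽₁] (H : Type u) [NormedAddCommGroup H]
    [InnerProductSpace 𝔽₁ H] [CompleteSpace H] [Nontrivial H] :
    Nontrivial (OpCat.full k 𝔽₁ 𝔽₂ H).X :=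
  (Submodule.topEquiv (R := 𝔽₁) (M := H →L[𝔽₁] H)).toEquiv.nontrivial

instance {k : OpKind} {𝔽 : Type} (A : OpCat.{u} k ℂ 𝔽) [Nontrivial A.X] : Nontrivial A.toReal.X :=
  (realEquiv A.X).symm.toEquiv.nontrivial

/-- A complex object, regarded as an object of the intermediate category. -/
def OpCat.toIntermediate {k : OpKind} (A : OpCat.{u} k ℂ ℂ) : OpCat.{u} k ℂ ℝ where
  H := A.H
  X := A.X
  one_mem := A.one_mem
  star_mem := A.star_mem

/-- The counit `x + iy ↦ x + i • y`, as a morphism of the complex category. -/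
noncomputable def counitHom {k : OpKind} (A : OpCat.{u} k ℂ ℂ) :
    A.toIntermediate.toReal.complexify ⟶ A :=
  OpHom.mk (complexifyCounit A.X).toAddMonoidHom (complexifyCounit A.X).map_smul
    (.complexifyCounit k)

theorem complexify_ne_counitHom {k : OpKind} {R : OpCat.{u} k ℝ ℝ} [Nontrivial R.X]
    (f : OpHom R.complexify.toIntermediate.toReal R) :
    f.complexify ≠ counitHom R.complexify := by
  intro h
  obtain ⟨b, hb⟩ := exists_ne (0 : R.X)
  let x : R.complexify.toIntermediate.toReal.X := realEquiv (complexifySpace R.X) (mkX 0 b)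
  have counit_x : complexifyCounit (complexifySpace R.X) (mkX x 0) = mkX 0 b :=
    complexifyCounit_mkX_zero _
  have im_eq : imX (complexifyAdd f.hom (mkX x 0)) =
      imX (complexifyCounit (complexifySpace R.X) (mkX x 0)) :=
    congrArg imX (DFunLike.congr_fun (congrArg OpHom.hom h) _)
  refine hb ?_
  calc b = imX (complexifyAdd f.hom (mkX x 0)) := by rw [im_eq, counit_x, imX_mkX]
    _ = f.hom (imX (mkX x 0)) := by rw [complexifyAdd_apply, imX_mkX]
    _ = 0 := by rw [imX_mkX, map_zero]

theorem not_full_complexification (k : OpKind) : ¬ (complexification.{u} k).Full := by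
  intro h
  obtain ⟨f, hf⟩ := h.map_surjective
    (counitHom (OpCat.full k ℝ ℝ (EuclideanSpace ℝ PUnit.{u + 1})).complexify)
  exact complexify_ne_counitHom f hf

theorem not_full_intermediateComplexification (k : OpKind) :
    ¬ (intermediateComplexification.{u} k).Full := by
  intro h
  obtain ⟨f, hf⟩ := h.map_surjective
    (counitHom (OpCat.full k ℂ ℝ (EuclideanSpace ℂ PUnit.{u + 1})).toReal.complexify)
  exact complexify_ne_counitHom f.toReal hf

section TrivialAction

variable (G : Type v) [Group G]

/-- The functor giving each object the trivial action of `G`. -/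
def trivialActionFunctor (k : OpKind) (𝔽₁ 𝔽₂ : Type) [RCLike 𝔽₁] [Field 𝔽₂] [Algebra 𝔽₂ 𝔽₁] :
    OpCat.{u} k 𝔽₁ 𝔽₂ ⥤ GOpCat.{u} G k 𝔽₁ 𝔽₂ where
  obj A := A.trivialAction G
  map f := GOpHom.mk f fun _ _ => rfl

variable {G} {k l : OpKind} {𝔽₁ 𝔽₂ 𝔽₃ 𝔽₄ : Type} [RCLike 𝔽₁] [Field 𝔽₂] [Algebra 𝔽₂ 𝔽₁]
  [RCLike 𝔽₃] [Field 𝔽₄] [Algebra 𝔽₄ 𝔽₃]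

instance : (trivialActionFunctor.{u} G k 𝔽₁ 𝔽₂).Faithful where
  map_injective h := congrArg GOpHom.toOpHom h

instance : (trivialActionFunctor.{u} G k 𝔽₁ 𝔽₂).Full where
  map_surjective f := ⟨GOpHom.toOpHom f, rfl⟩

/-- An object on which `G` acts trivially is isomorphic to the one with the trivial action. -/
def isoTrivialAction (A : GOpCat.{u} G k 𝔽₁ 𝔽₂) (h : ∀ g x, A.ρ g x = x) :
    A ≅ A.toOpCat.trivialAction G where
  hom := GOpHom.mk (𝟙 A.toOpCat) h
  inv := GOpHom.mk (𝟙 A.toOpCat) fun g x => (h g x).symm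

theorem full_of_trivialActionFunctor {F : OpCat.{u} k 𝔽₁ 𝔽₂ ⥤ OpCat.{u} l 𝔽₃ 𝔽₄}
    {F' : GOpCat.{u} G k 𝔽₁ 𝔽₂ ⥤ GOpCat.{u} G l 𝔽₃ 𝔽₄} [F'.Full]
    (e : trivialActionFunctor G k 𝔽₁ 𝔽₂ ⋙ F' ≅ F ⋙ trivialActionFunctor G l 𝔽₃ 𝔽₄) : F.Full :=
  have := Functor.Full.of_iso e
  Functor.Full.of_comp_faithful F (trivialActionFunctor G l 𝔽₃ 𝔽₄)

variable (G)

theorem not_full_complexificationG (k : OpKind) : ¬ (complexificationG.{u} G k).Full := fun _ =>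
  not_full_complexification k <| full_of_trivialActionFunctor (F' := complexificationG G k) <|
    NatIso.ofComponents fun _ => isoTrivialAction _ fun _ => mkX_eta

theorem not_full_intermediateComplexificationG (k : OpKind) :
    ¬ (intermediateComplexificationG.{u} G k).Full := fun _ =>
  not_full_intermediateComplexification k <|
    full_of_trivialActionFunctor (F' := intermediateComplexificationG G k) <|
      NatIso.ofComponents fun A => isoTrivialAction _ fun _ s => by
        change mkX (realFun (AddMonoidHom.id A.X) (reX (X := realSpace A.X) s))
          (realFun (AddMonoidHom.id A.X) (imX (X := realSpace A.X) s)) = s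
        rw [realFun_id, realFun_id]
        exact mkX_eta s

end TrivialAction

end NotFull

section ColumnSpace

variable {𝔽 : Type*} [RCLike 𝔽] {H : Type*} [NormedAddCommGroup H] [InnerProductSpace 𝔽 H]

theorem norm_matOp_row_le_one_iff {X : Submodule 𝔽 (H →L[𝔽] H)} {a b : X} :
    ‖matOp !![a, b; 0, 0]‖ ≤ 1 ↔
      ∀ v w : H, ‖(a : H →L[𝔽] H) v + (b : H →L[𝔽] H) w‖ ^ 2 ≤ ‖v‖ ^ 2 + ‖w‖ ^ 2 := by
  have norm_sq_apply (u : PiLp 2 fun _ : Fin 2 => H) :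
      ‖matOp !![a, b; 0, 0] u‖ ^ 2 = ‖(a : H →L[𝔽] H) (u 0) + (b : H →L[𝔽] H) (u 1)‖ ^ 2 := by
    simp [PiLp.norm_sq_eq_of_L2, matOp_apply]
  constructor
  · intro h v w
    have := pow_le_pow_left₀ (norm_nonneg _)
      ((matOp !![a, b; 0, 0]).le_of_opNorm_le h (WithLp.toLp 2 ![v, w])) 2
    rw [norm_sq_apply] at this
    simpa [PiLp.norm_sq_eq_of_L2] using this
  · refine fun h => ContinuousLinearMap.opNorm_le_bound _ zero_le_one fun u => ?_
    rw [one_mul, ← sq_le_sq₀ (norm_nonneg _) (norm_nonneg _), norm_sq_apply,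
      PiLp.norm_sq_eq_of_L2, Fin.sum_univ_two]
    exact h _ _

theorem eq_zero_of_norm_row_le_one {X : Submodule 𝔽 (H →L[𝔽] H)} {e x : X}
    (he : (e : H →L[𝔽] H) = 1) (h : ‖matOp !![e, x; 0, 0]‖ ≤ 1) : x = 0 := by
  ext w
  set p := (x : H →L[𝔽] H) w with hp
  change p = 0
  have growth (s : ℝ) : (s + 1) ^ 2 * ‖p‖ ^ 2 ≤ s ^ 2 * ‖p‖ ^ 2 + ‖w‖ ^ 2 := by
    have := norm_matOp_row_le_one_iff.1 h ((s : 𝔽) • p) w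
    have smul_add : (s : 𝔽) • p + p = ((s + 1 : ℝ) : 𝔽) • p := by
      push_cast
      module
    rw [he, one_apply_eq_self, ← hp, smul_add, norm_smul, norm_smul, mul_pow, mul_pow] at this
    norm_cast at this
    simpa only [RCLike.norm_ofReal, sq_abs] using this
  by_contra hne
  have := growth (‖w‖ ^ 2 / ‖p‖ ^ 2)
  have : ‖w‖ ^ 2 / ‖p‖ ^ 2 * ‖p‖ ^ 2 = ‖w‖ ^ 2 := div_mul_cancel₀ _ (by simpa using hne)
  nlinarith [sq_pos_of_pos (norm_pos_iff.2 hne)]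

variable (𝔽) in
/-- The rank one operators `v ↦ ⟪e, v⟫ • c`, for `c` in `H`. -/
noncomputable def columnOp (e : H) : H →ₗ[𝔽] H →L[𝔽] H :=
  ((InnerProductSpace.rankOne 𝔽).flip e : H →L[𝔽] H →L[𝔽] H)

theorem columnOp_apply (e c v : H) : columnOp 𝔽 e c v = ⟪e, v⟫_𝔽 • c := by
  simp [columnOp]

theorem norm_columnOp {e : H} (he : ‖e‖ = 1) (c : H) : ‖columnOp 𝔽 e c‖ = ‖c‖ := by
  simp [columnOp, he]

theorem norm_matOp_row_columnOp_le_one {e c d : H} (he : ‖e‖ = 1) (hc : ‖c‖ ≤ 1) (hd : ‖d‖ ≤ 1)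
    (hcd : ⟪c, d⟫_𝔽 = 0) {a b : LinearMap.range (columnOp 𝔽 e)}
    (ha : a = columnOp 𝔽 e c) (hb : b = columnOp 𝔽 e d) :
    ‖matOp !![a, b; 0, 0]‖ ≤ 1 := by
  refine norm_matOp_row_le_one_iff.2 fun v w => ?_
  have orthogonal : ⟪columnOp 𝔽 e c v, columnOp 𝔽 e d w⟫_𝔽 = 0 := by
    simp [columnOp_apply, inner_smul_left, inner_smul_right, hcd]
  have contraction {c : H} (hc : ‖c‖ ≤ 1) (v : H) : ‖columnOp 𝔽 e c v‖ ≤ ‖v‖ := by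
    simpa using (columnOp 𝔽 e c).le_of_opNorm_le ((norm_columnOp he c).trans_le hc) v
  rw [ha, hb, @norm_add_sq 𝔽, orthogonal, map_zero, mul_zero, add_zero]
  gcongr
  exacts [contraction hc v, contraction hd w]

theorem exists_norm_eq_one_inner_eq_zero (h : 1 < Module.rank 𝔽 H) (c : H) :
    ∃ d : H, ‖d‖ = 1 ∧ ⟪c, d⟫_𝔽 = 0 := by
  have : (𝔽 ∙ c)ᗮ ≠ ⊥ := by
    rw [Ne, Submodule.orthogonal_eq_bot_iff]
    intro span_eq_top
    refine h.not_ge (rank_le_one_iff.2 ⟨c, fun v => ?_⟩)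
    exact Submodule.mem_span_singleton.1 (span_eq_top ▸ Submodule.mem_top)
  obtain ⟨d, hd, hd0⟩ := Submodule.exists_mem_ne_zero_of_ne_bot this
  refine ⟨(‖d‖⁻¹ : 𝔽) • d, norm_smul_inv_norm hd0, ?_⟩
  rw [inner_smul_right, Submodule.mem_orthogonal_singleton_iff_inner_right.1 hd, mul_zero]

end ColumnSpace

section ForgetUnit

variable (𝔽₁ 𝔽₂ : Type) [RCLike 𝔽₁] [Field 𝔽₂] [Algebra 𝔽₂ 𝔽₁]

/-- The column Hilbert space of `H`, realized as the operators of rank one supported on `e`. -/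
noncomputable def columnSpace {H : Type u} [NormedAddCommGroup H] [InnerProductSpace 𝔽₁ H]
    [CompleteSpace H] (e : H) : OpCat.{u} .space 𝔽₁ 𝔽₂ where
  H := H
  X := LinearMap.range (columnOp 𝔽₁ e)
  one_mem h := absurd rfl h
  star_mem := nofun

variable {𝔽₁ 𝔽₂}

theorem isEmpty_iso_columnSpace {H : Type u} [NormedAddCommGroup H] [InnerProductSpace 𝔽₁ H]
    [CompleteSpace H] (hH : 1 < Module.rank 𝔽₁ H) {e : H} (he : ‖e‖ = 1)
    (A : OpCat.{u} .unital 𝔽₁ 𝔽₂) :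
    IsEmpty ((forgetUnit 𝔽₁ 𝔽₂).obj A ≅ columnSpace 𝔽₁ 𝔽₂ e) := by
  refine ⟨fun φ => ?_⟩
  let f : A.X →+ LinearMap.range (columnOp 𝔽₁ e) := OpHom.hom φ.hom
  let g : LinearMap.range (columnOp 𝔽₁ e) →+ A.X := OpHom.hom φ.inv
  have gf (x) : g (f x) = x := iso_inv_hom_apply φ x
  have fg (y) : f (g y) = y := iso_hom_inv_apply φ y
  have hf : CompletelyContractive f := OpHom.isMorphism φ.hom
  have hg : CompletelyContractive g := OpHom.isMorphism φ.inv
  let one : A.X := ⟨1, A.one_mem nofun⟩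
  obtain ⟨c, hc⟩ := (f one).2
  have norm_c : ‖c‖ ≤ 1 := by
    rw [← norm_columnOp (𝔽 := 𝔽₁) he, hc]
    exact (hf.norm_le one).trans ContinuousLinearMap.norm_id_le
  obtain ⟨d, norm_d, hcd⟩ := exists_norm_eq_one_inner_eq_zero hH c
  let b : LinearMap.range (columnOp 𝔽₁ e) := ⟨columnOp 𝔽₁ e d, d, rfl⟩
  have map_row : (!![f one, b; 0, 0]).map g = !![one, g b; 0, 0] := by
    ext i j : 2
    fin_cases i <;> fin_cases j <;> simp [gf]
  have row_le := norm_matOp_row_columnOp_le_one he norm_c norm_d.le hcd hc.symm (b := b) rfl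
  have gb : g b = 0 := eq_zero_of_norm_row_le_one rfl (map_row ▸ (hg 2 _).trans row_le)
  have hb : b = 0 := by rw [← fg b, gb, map_zero]
  have : ‖d‖ = 0 := by
    have columnOp_eq_zero : columnOp 𝔽₁ e d = 0 := congrArg Subtype.val hb
    rw [← norm_columnOp (𝔽 := 𝔽₁) he, columnOp_eq_zero, norm_zero]
  exact one_ne_zero (norm_d.symm.trans this)

variable (𝔽₁ 𝔽₂)

theorem not_essSurj_forgetUnit : ¬ (forgetUnit.{u} 𝔽₁ 𝔽₂).EssSurj := by
  intro _
  let e : EuclideanSpace 𝔽₁ (ULift.{u} (Fin 2)) := EuclideanSpace.single 0 1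
  refine (isEmpty_iso_columnSpace ?_ (e := e) (by simp [e]) _).false
    ((forgetUnit 𝔽₁ 𝔽₂).objObjPreimageIso (columnSpace 𝔽₁ 𝔽₂ e))
  rw [← Module.finrank_eq_rank, finrank_euclideanSpace]
  simp

theorem not_essSurj_forgetUnitG (G : Type v) [Group G] :
    ¬ (forgetUnitG.{u} 𝔽₁ 𝔽₂ G).EssSurj := fun _ =>
  not_essSurj_forgetUnit 𝔽₁ 𝔽₂ (essSurj_of_forgetAction (F' := forgetUnitG 𝔽₁ 𝔽₂ G) (Iso.refl _))

end ForgetUnit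

section Quaternions

open scoped Quaternion

/-- The operator of left multiplication by a quaternion, as an element of the space formed by these
operators. -/
noncomputable def quat : ℍ[ℝ] →+ LinearMap.range quaternionOp.{u} :=
  quaternionOp.rangeRestrict.toAddMonoidHom

theorem quat_surjective : Function.Surjective quat.{u} := LinearMap.surjective_rangeRestrict _

theorem quat_neg (a : ℍ[ℝ]) : quat.{u} (-a) = -quat a := Subtype.ext (map_neg quaternionOp a)

theorem norm_piLp_punit {E : Type*} [NormedAddCommGroup E] (v : PiLp 2 fun _ : PUnit.{u + 1} => E) :
    ‖v‖ = ‖v ⟨⟩‖ := by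
  simp [PiLp.norm_eq_of_L2]

theorem norm_quaternionOp (a : ℍ[ℝ]) : ‖quaternionOp.{u} a‖ = ‖a‖ := by
  refine ContinuousLinearMap.homothety_norm _ fun v => ?_
  rw [norm_piLp_punit, norm_piLp_punit, quaternionOp_apply, norm_mul]

theorem norm_quat (a : ℍ[ℝ]) : ‖(quat.{u} a).1‖ = ‖a‖ := norm_quaternionOp a

theorem norm_sq_matOp_quat (a b c d : ℍ[ℝ])
    (v : PiLp 2 fun _ : Fin 2 => PiLp 2 fun _ : PUnit.{u + 1} => ℍ[ℝ]) :
    ‖matOp !![quat.{u} a, quat b; quat c, quat d] v‖ ^ 2 =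
      ‖a * v 0 ⟨⟩ + b * v 1 ⟨⟩‖ ^ 2 + ‖c * v 0 ⟨⟩ + d * v 1 ⟨⟩‖ ^ 2 := by
  simp [PiLp.norm_sq_eq_of_L2 _ (matOp _ v), matOp_apply, norm_piLp_punit, quat, quaternionOp_apply]

theorem mul_star_eq_one_of_norm_eq_one {a : ℍ[ℝ]} (ha : ‖a‖ = 1) : a * star a = 1 := by
  rw [Quaternion.self_mul_star, Quaternion.normSq_eq_norm_mul_self, ha, mul_one,
    Quaternion.coe_one]

theorem two_le_norm_matOp_quat {b c : ℍ[ℝ]} (hb : ‖b‖ = 1) (hc : ‖c‖ = 1) :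
    2 ≤ ‖matOp !![quat.{u} 1, quat b; quat c, quat (c * b)]‖ := by
  let v : PiLp 2 fun _ : Fin 2 => PiLp 2 fun _ : PUnit.{u + 1} => ℍ[ℝ] :=
    WithLp.toLp 2 ![WithLp.toLp 2 fun _ => 1, WithLp.toLp 2 fun _ => star b]
  have norm_sq_v : ‖v‖ ^ 2 = 2 := by
    simp only [PiLp.norm_sq_eq_of_L2 _ v, Fin.sum_univ_two, v, norm_piLp_punit]
    simp [hb, one_add_one_eq_two]
  have norm_add_self {a : ℍ[ℝ]} (ha : ‖a‖ = 1) : ‖a + a‖ = 2 := by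
    rw [← two_smul ℝ, norm_smul, ha, mul_one, Real.norm_two]
  have bound := pow_le_pow_left₀ (norm_nonneg _)
    ((matOp !![quat.{u} 1, quat b; quat c, quat (c * b)]).le_opNorm v) 2
  rw [norm_sq_matOp_quat, mul_pow, norm_sq_v] at bound
  simp only [v, Matrix.cons_val_zero, Matrix.cons_val_one, mul_one, mul_assoc,
    mul_star_eq_one_of_norm_eq_one hb, norm_add_self norm_one, norm_add_self hc] at bound
  nlinarith [norm_nonneg (matOp !![quat.{u} 1, quat b; quat c, quat (c * b)])]

theorem norm_matOp_quat_le {b c d : ℍ[ℝ]} (hb : ‖b‖ = 1) (hc : ‖c‖ = 1) (hd : ‖d‖ = 1) :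
    ‖matOp !![quat.{u} 1, quat b; quat c, quat d]‖ ≤ √(2 + ‖b + star c * d‖) := by
  set r := star c * d with hr
  have norm_r : ‖r‖ = 1 := by rw [hr, norm_mul, norm_star, hc, hd, one_mul]
  have hd_eq : d = c * r := by rw [hr, ← mul_assoc, mul_star_eq_one_of_norm_eq_one hc, one_mul]
  refine ContinuousLinearMap.opNorm_le_bound _ (Real.sqrt_nonneg _) fun v => ?_
  refine le_of_sq_le_sq ?_ (by positivity)
  rw [mul_pow, Real.sq_sqrt (by positivity), norm_sq_matOp_quat, PiLp.norm_sq_eq_of_L2,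
    Fin.sum_univ_two, norm_piLp_punit, norm_piLp_punit, hd_eq, mul_assoc, ← mul_add,
    norm_mul, hc, one_mul, one_mul, norm_add_sq_real, norm_add_sq_real, norm_mul, norm_mul, hb,
    norm_r]
  have cross_terms := real_inner_le_norm (v 0 ⟨⟩) ((b + r) * v 1 ⟨⟩)
  rw [norm_mul, add_mul, inner_add_right] at cross_terms
  nlinarith [mul_nonneg (norm_nonneg (b + r)) (sq_nonneg (‖v 0 ⟨⟩‖ - ‖v 1 ⟨⟩‖))]

theorem eq_of_two_le_norm_matOp_quat {b c d : ℍ[ℝ]} (hb : ‖b‖ = 1) (hc : ‖c‖ = 1) (hd : ‖d‖ = 1)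
    (h : 2 ≤ ‖matOp !![quat.{u} 1, quat b; quat c, quat d]‖) : b = star c * d := by
  have two_le : 2 ≤ ‖b + star c * d‖ := by
    have := (Real.le_sqrt' two_pos).1 (h.trans (norm_matOp_quat_le hb hc hd))
    linarith
  have parallelogram := parallelogram_law_with_norm ℝ b (star c * d)
  rw [norm_mul, norm_star, hb, hc, hd] at parallelogram
  have : ‖b - star c * d‖ = 0 := by nlinarith [norm_nonneg (b - star c * d)]
  exact sub_eq_zero.1 (norm_eq_zero.1 this)

theorem eq_zero_of_commute {w : ℍ[ℝ]} (h : ∀ b : ℍ[ℝ], ‖b‖ = 1 → w * b = b * w)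
    (hw : star w = -w) : w = 0 := by
  have norm_eq_one {a : ℍ[ℝ]} (ha : a.re ^ 2 + a.imI ^ 2 + a.imJ ^ 2 + a.imK ^ 2 = 1) :
      ‖a‖ = 1 := by
    rw [← Quaternion.normSq_def', Quaternion.normSq_eq_norm_mul_self] at ha
    nlinarith [norm_nonneg a]
  let i : ℍ[ℝ] := ⟨0, 1, 0, 0⟩
  let j : ℍ[ℝ] := ⟨0, 0, 1, 0⟩
  have commute_i : w * i = i * w := h i (norm_eq_one (by simp [i]))
  have commute_j : w * j = j * w := h j (norm_eq_one (by simp [j]))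
  have re_eq : w.re = 0 := by simpa [self_eq_neg] using congrArg QuaternionAlgebra.re hw
  have imK_eq_i := congrArg QuaternionAlgebra.imK commute_i
  have imJ_eq_i := congrArg QuaternionAlgebra.imJ commute_i
  have imK_eq_j := congrArg QuaternionAlgebra.imK commute_j
  rw [Quaternion.imK_mul, Quaternion.imK_mul] at imK_eq_i imK_eq_j
  rw [Quaternion.imJ_mul, Quaternion.imJ_mul] at imJ_eq_i
  simp only [i, j] at imK_eq_i imJ_eq_i imK_eq_j
  refine QuaternionAlgebra.ext re_eq ?_ ?_ ?_ <;>
    simp only [Quaternion.imI_zero, Quaternion.imJ_zero, Quaternion.imK_zero] <;> linarith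

/-- With `J` in the role of `i`, the matrices of norm `2` give
`-J b = star (J 1) * b = b * star (J 1)` for every unit `b`, so that the purely imaginary quaternion
`star (J 1)` would be central. -/
theorem not_isometric_conj_quaternion (J : ℍ[ℝ] → ℍ[ℝ]) (hJ : ∀ a, ‖J a‖ = ‖a‖)
    (h : ∀ b c d : ℍ[ℝ], ‖matOp !![quat.{u} 1, quat b; quat c, quat d]‖ ≤
      ‖matOp !![quat.{u} 1, quat (-J b); quat (J c), quat d]‖) : False := by
  have neg_J {b c : ℍ[ℝ]} (hb : ‖b‖ = 1) (hc : ‖c‖ = 1) : -J b = star (J c) * (c * b) :=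
    eq_of_two_le_norm_matOp_quat (by rw [norm_neg, hJ, hb]) (by rw [hJ, hc])
      (by rw [norm_mul, hb, hc, one_mul]) ((two_le_norm_matOp_quat.{u} hb hc).trans (h _ _ _))
  have neg_J_left {b : ℍ[ℝ]} (hb : ‖b‖ = 1) : -J b = star (J 1) * b := by
    rw [neg_J hb norm_one, one_mul]
  have neg_J_right {b : ℍ[ℝ]} (hb : ‖b‖ = 1) : -J b = b * star (J 1) := by
    have := congrArg star (neg_J norm_one hb)
    rw [mul_one, star_mul, star_star, star_neg] at this
    rw [← neg_neg (star (J 1)), this, mul_neg, ← mul_assoc, mul_star_eq_one_of_norm_eq_one hb,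
      one_mul]
  have : star (J 1) = 0 := by
    refine eq_zero_of_commute (fun b hb => (neg_J_left hb).symm.trans (neg_J_right hb)) ?_
    rw [star_star, ← mul_one (star (J 1)), ← neg_J_left norm_one, neg_neg]
  have : ‖star (J 1)‖ = 1 := by rw [norm_star, hJ, norm_one]
  simp_all

theorem map_two_by_two {α β : Type*} (f : α → β) (a b c d : α) :
    !![a, b; c, d].map f = !![f a, f b; f c, f d] := by
  ext i j
  fin_cases i <;> fin_cases j <;> rfl

theorem norm_matOp_conj_I {H : Type*} [NormedAddCommGroup H] [InnerProductSpace ℂ H]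
    {X : Submodule ℂ (H →L[ℂ] H)} (a b c d : X) :
    ‖matOp !![a, b; c, d]‖ = ‖matOp !![a, -(Complex.I • b); Complex.I • c, d]‖ := by
  let U : PiLp 2 (fun _ : Fin 2 => H) → PiLp 2 (fun _ : Fin 2 => H) :=
    fun v => WithLp.toLp 2 ![v 0, Complex.I • v 1]
  refine opNorm_eq_of_intertwine _ _ U (fun v => ⟨WithLp.toLp 2 ![v 0, -Complex.I • v 1], ?_⟩)
    (fun v => ?_) (fun v => ?_)
  · ext i
    fin_cases i <;> simp [U, smul_smul]
  · rw [← sq_eq_sq₀ (norm_nonneg _) (norm_nonneg _), PiLp.norm_sq_eq_of_L2, PiLp.norm_sq_eq_of_L2]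
    simp [U, norm_smul]
  · ext i
    fin_cases i <;> simp [U, matOp_apply, smul_smul, map_smul]

section MulI

attribute [local instance] InnerProductSpace.complexToReal

variable {H : Type*} [NormedAddCommGroup H] [InnerProductSpace ℂ H] {X : Submodule ℂ (H →L[ℂ] H)}

/-- Multiplication by `i` on a complex space, regarded as a real space. -/
noncomputable def mulI (x : realSpace X) : realSpace X :=
  realEquiv X (Complex.I • (realEquiv X).symm x)

theorem norm_realEquiv (x : X) : ‖(realEquiv X x : H →L[ℝ] H)‖ = ‖(x : H →L[ℂ] H)‖ :=
  ContinuousLinearMap.norm_restrictScalars (x : H →L[ℂ] H)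

theorem norm_mulI (x : realSpace X) : ‖(mulI x : H →L[ℝ] H)‖ = ‖(x : H →L[ℝ] H)‖ := by
  rw [mulI, norm_realEquiv, Submodule.coe_smul, norm_smul, Complex.norm_I, one_mul,
    ← norm_realEquiv, AddEquiv.apply_symm_apply]

theorem norm_matOp_conj_mulI (a b c d : realSpace X) :
    ‖matOp !![a, b; c, d]‖ = ‖matOp !![a, -mulI b; mulI c, d]‖ := by
  have symm_neg : ∀ y, (realEquiv X).symm (-y) = -(realEquiv X).symm y :=
    AddMonoidHom.map_neg (realEquiv X).symm.toAddMonoidHom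
  have symm_mulI : ∀ y, (realEquiv X).symm (mulI y) = Complex.I • (realEquiv X).symm y :=
    fun y => (realEquiv X).symm_apply_apply _
  rw [(matOp_real !![a, b; c, d]).1, (matOp_real !![a, -mulI b; mulI c, d]).1, map_two_by_two,
    map_two_by_two, symm_neg, symm_mulI, symm_mulI, norm_matOp_conj_I]

theorem not_completeIsometry_quaternion (f : realSpace X →+ LinearMap.range quaternionOp.{u})
    (g : LinearMap.range quaternionOp.{u} →+ realSpace X) (hgf : ∀ x, g (f x) = x)
    (hfg : ∀ y, f (g y) = y) (hf : CompletelyContractive f) (hg : CompletelyContractive g) :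
    False := by
  choose J hJ using fun a => quat_surjective.{u} (f (mulI (g (quat a))))
  have g_J (a : ℍ[ℝ]) : g (quat (J a)) = mulI (g (quat a)) := by rw [hJ, hgf]
  have g_neg_J (a : ℍ[ℝ]) : g (quat (-J a)) = -mulI (g (quat a)) := by
    rw [quat_neg, AddMonoidHom.map_neg g, g_J]
  have norm_g (y) : ‖(g y).1‖ = ‖y.1‖ :=
    le_antisymm (hg.norm_le y) (by simpa only [hfg] using hf.norm_le (g y))
  refine not_isometric_conj_quaternion.{u} J
    (fun a => by rw [← norm_quat.{u}, ← norm_g, g_J, norm_mulI, norm_g, norm_quat])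
    fun b c d => ?_
  calc ‖matOp !![quat.{u} 1, quat b; quat c, quat d]‖
      = ‖matOp (!![g (quat 1), g (quat b); g (quat c), g (quat d)].map f)‖ := by
        simp only [map_two_by_two, hfg]
    _ ≤ ‖matOp !![g (quat 1), g (quat b); g (quat c), g (quat d)]‖ := hf 2 _
    _ = ‖matOp (!![quat 1, quat (-J b); quat (J c), quat d].map g)‖ := by
        rw [norm_matOp_conj_mulI, map_two_by_two, g_neg_J, g_J]
    _ ≤ ‖matOp !![quat 1, quat (-J b); quat (J c), quat d]‖ := hg 2 _

end MulI

theorem isEmpty_iso_quaternionSpace (k : OpKind) (Z : OpCat.{u} k ℂ ℂ) :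
    IsEmpty ((forgetToReal.{u} k ℂ).obj Z ≅ quaternionSpace.{u} k) :=
  ⟨fun φ => not_completeIsometry_quaternion (X := Z.X) φ.hom.hom φ.inv.hom
    (iso_inv_hom_apply φ) (iso_hom_inv_apply φ)
    (OpHom.completelyContractive (fun _ => rfl) φ.hom)
    (OpHom.completelyContractive (fun _ => rfl) φ.inv)⟩

theorem not_essSurj_forgetToReal (k : OpKind) : ¬ (forgetToReal.{u} k ℂ).EssSurj := fun _ =>
  (isEmpty_iso_quaternionSpace k _).false ((forgetToReal k ℂ).objObjPreimageIso (quaternionSpace k))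

variable (G : Type v) [Group G]

theorem isEmpty_iso_quaternionSpaceG (k : OpKind) (Z : GOpCat.{u} G k ℂ ℂ) :
    IsEmpty ((forgetToRealG.{u} G k ℂ).obj Z ≅ (quaternionSpace.{u} k).trivialAction G) :=
  ⟨fun φ => (isEmpty_iso_quaternionSpace k Z.toOpCat).false ((forgetAction G k ℝ ℝ).mapIso φ)⟩

theorem not_essSurj_forgetToRealG (k : OpKind) : ¬ (forgetToRealG.{u} G k ℂ).EssSurj := fun _ =>
  (isEmpty_iso_quaternionSpaceG G k _).false
    ((forgetToRealG G k ℂ).objObjPreimageIso ((quaternionSpace k).trivialAction G))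

end Quaternions

section Conjugation

theorem exists_conjugation {k : OpKind} {A : OpCat.{u} k ℝ ℝ} {Z : OpCat.{u} k ℂ ℂ}
    (φ : A.complexify ≅ Z) :
    ∃ θ : Z.X →ₛₗ[starRingEnd ℂ] Z.X, Function.Involutive θ ∧ IsMorphism k θ := by
  let f : complexifySpace A.X →ₗ[ℂ] Z.X :=
    { OpHom.hom φ.hom with map_smul' := OpHom.map_smul φ.hom }
  let g : Z.X →ₗ[ℂ] complexifySpace A.X :=
    { OpHom.hom φ.inv with map_smul' := OpHom.map_smul φ.inv }
  have hgf : ∀ x, g (f x) = x := iso_inv_hom_apply φ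
  have hfg : ∀ y, f (g y) = y := iso_hom_inv_apply φ
  refine ⟨f.comp (conjX.comp g), fun y => ?_,
    (OpHom.isMorphism φ.hom).comp ((IsMorphism.conjX k).comp (OpHom.isMorphism φ.inv))⟩
  change f (conjX (g (f (conjX (g y))))) = y
  rw [hgf, conjX_involutive, hfg]

theorem IsMorphism.norm_le {k : OpKind} (hk : k ≠ .system) {H K : Type*} [NormedAddCommGroup H]
    [InnerProductSpace ℂ H] [NormedAddCommGroup K] [InnerProductSpace ℂ K]
    {X : Submodule ℂ (H →L[ℂ] H)} {Y : Submodule ℂ (K →L[ℂ] K)} {f : X → Y}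
    (hf : IsMorphism k f) (x : X) : ‖f x‖ ≤ ‖x‖ :=
  match k, hk, hf with
  | .space, _, hf => CompletelyContractive.norm_le hf x
  | .unital, _, hf => CompletelyContractive.norm_le hf.2 x

end Conjugation

section MaximumNorm

theorem eq_zero_of_eventually_norm_add_mul_le {w z : ℂ}
    (h : ∀ᶠ t in nhds (0 : ℂ), ‖w + t * z‖ ≤ ‖w‖) : z = 0 := by
  have hmax : IsLocalMax (norm ∘ fun t : ℂ => w + t * z) 0 := by
    filter_upwards [h] with t ht
    simpa using ht
  have hconst := Complex.eventually_eq_of_isLocalMax_norm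
    (Filter.Eventually.of_forall fun t => by fun_prop) hmax
  obtain ⟨t, ht, ht0⟩ := ((hconst.filter_mono nhdsWithin_le_nhds).and
    (self_mem_nhdsWithin : {0}ᶜ ∈ nhdsWithin (0 : ℂ) {0}ᶜ)).exists
  exact (mul_eq_zero.1 (by simpa using ht)).resolve_left ht0

variable {ι V : Type*} [Finite ι] [Nontrivial ι] [SeminormedAddCommGroup V] [Module ℂ V]
  {f : ι → V →ₗ[ℂ] ℂ} {T : V →ₛₗ[starRingEnd ℂ] V}

theorem exists_functional_comp_eq_mul_conj
    (norm_isGreatest : ∀ x, IsGreatest (Set.range fun i => ‖f i x‖) ‖x‖)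
    (hT : ∀ x, ‖T x‖ = ‖x‖) {j : ι} {x : V} (hx : ∀ i ≠ j, ‖f i x‖ < ‖f j x‖) :
    ∃ i c, c ≠ 0 ∧ ∀ y, f i (T y) = c * starRingEnd ℂ (f j y) := by
  have norm_le (i y) : ‖f i y‖ ≤ ‖y‖ := (norm_isGreatest y).2 ⟨i, rfl⟩
  have norm_x : ‖x‖ = ‖f j x‖ := by
    refine le_antisymm ?_ (norm_le j x)
    obtain ⟨i, hi : ‖f i x‖ = ‖x‖⟩ := (norm_isGreatest x).1
    rcases eq_or_ne i j with rfl | hij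
    exacts [hi.ge, hi ▸ (hx i hij).le]
  have hfx : f j x ≠ 0 := by
    obtain ⟨i, hij⟩ := exists_ne j
    exact norm_pos_iff.1 ((norm_nonneg _).trans_lt (hx i hij))
  obtain ⟨i, hi : ‖f i (T x)‖ = ‖T x‖⟩ := (norm_isGreatest (T x)).1
  have norm_fTx : ‖f i (T x)‖ = ‖f j x‖ := by rw [hi, hT, norm_x]
  have kernel_le (y) (hy : f j y = 0) : f i (T y) = 0 := by
    have perturbation : ∀ᶠ t in nhds (0 : ℂ), ∀ l, ‖f l (x + starRingEnd ℂ t • y)‖ ≤ ‖f j x‖ := by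
      refine Filter.eventually_all.2 fun l => ?_
      rcases eq_or_ne l j with rfl | hl
      · exact Filter.Eventually.of_forall fun t => by simp [hy]
      · have hcont : Continuous fun t : ℂ => ‖f l (x + starRingEnd ℂ t • y)‖ := by
          simp only [map_add, map_smul]
          fun_prop
        exact (hcont.tendsto' 0 ‖f l x‖ (by simp)).eventually_le_const (hx l hl)
    refine eq_zero_of_eventually_norm_add_mul_le (w := f i (T x)) ?_
    filter_upwards [perturbation] with t ht
    obtain ⟨l, hl : ‖f l _‖ = _⟩ := (norm_isGreatest (x + starRingEnd ℂ t • y)).1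
    calc ‖f i (T x) + t * f i (T y)‖ = ‖f i (T (x + starRingEnd ℂ t • y))‖ := by simp
      _ ≤ ‖x + starRingEnd ℂ t • y‖ := hT (x + starRingEnd ℂ t • y) ▸ norm_le i _
      _ ≤ ‖f i (T x)‖ := norm_fTx ▸ hl ▸ ht l
  refine ⟨i, f i (T x) / starRingEnd ℂ (f j x), div_ne_zero ?_ (by simpa using hfx), fun y => ?_⟩
  · exact norm_pos_iff.1 (norm_fTx ▸ norm_pos_iff.2 hfx)
  · have h := kernel_le (y - (f j y / f j x) • x) (by simp [hfx])
    rw [map_sub, map_sub, map_smulₛₗ, map_smul, sub_eq_zero] at h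
    rw [h, smul_eq_mul, map_div₀]
    ring

theorem exists_perm_functional_comp_eq_mul_conj
    (norm_isGreatest : ∀ x, IsGreatest (Set.range fun i => ‖f i x‖) ‖x‖)
    (hT : ∀ x, ‖T x‖ = ‖x‖) {x : ι → V} (hx : ∀ i j, i ≠ j → ‖f i (x j)‖ < ‖f j (x j)‖) :
    ∃ (σ : Equiv.Perm ι) (c : ι → ℂ),
      ∀ j, c j ≠ 0 ∧ ∀ y, f (σ j) (T y) = c j * starRingEnd ℂ (f j y) := by
  choose σ c hc hσ using fun j =>
    exists_functional_comp_eq_mul_conj norm_isGreatest hT (fun i => hx i j)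
  have norm_lt {i j} (h : σ i = σ j) (hij : i ≠ j) : ‖c j‖ < ‖c i‖ := by
    have hxj := hx i j hij
    have hval : ‖c i‖ * ‖f i (x j)‖ = ‖c j‖ * ‖f j (x j)‖ := by
      simpa [h, hσ j] using (congrArg norm (hσ i (x j))).symm
    by_contra! hle
    have := mul_lt_mul_of_nonneg_of_pos hxj hle (norm_nonneg _) (norm_pos_iff.2 (hc j))
    linarith
  have hinj : Function.Injective σ := fun i j h =>
    by_contra fun hij => (norm_lt h hij).asymm (norm_lt h.symm (Ne.symm hij))
  exact ⟨.ofBijective σ (Finite.injective_iff_bijective.1 hinj), c, fun j => ⟨hc j, hσ j⟩⟩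

end MaximumNorm

section PolyhedralCone

open scoped ComplexOrder

theorem exists_forall_abs_le_mul {ι : Type*} [Finite ι] {a b : ι → ℝ} (ha : ∀ i, 0 ≤ a i)
    (hab : ∀ i, a i = 0 → b i = 0) : ∃ C, ∀ i, |b i| ≤ C * a i := by
  obtain ⟨C, hC⟩ := Finite.exists_le fun i => |b i| / a i
  refine ⟨C, fun i => ?_⟩
  rcases (ha i).eq_or_lt' with hi | hi
  · simp [hi, hab i hi]
  · exact (div_le_iff₀ hi).1 (hC i)

variable {ι V : Type*} [Finite ι] [AddCommGroup V] [Module ℂ V] {f : ι → V →ₗ[ℂ] ℂ} {u : V}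
  {θ : V →ₛₗ[starRingEnd ℂ] V}

theorem map_eq_zero_of_positive (hθ : ∀ x, (∀ i, 0 ≤ f i x) → ∀ i, 0 ≤ f i (θ x)) {i : ι} {x y : V}
    (hx : ∀ l, 0 ≤ f l x) (hi : f i (θ x) = 0) (hy : ∀ l, (f l y).im = 0)
    (hxy : ∀ l, f l x = 0 → f l y = 0) : f i (θ y) = 0 := by
  have hx_re (l) : f l x = (f l x).re := Complex.eq_re_of_ofReal_le (hx l)
  have hy_re (l) : f l y = (f l y).re := Complex.ext rfl (hy l)
  obtain ⟨C, hC⟩ := exists_forall_abs_le_mul (a := fun l => (f l x).re) (b := fun l => (f l y).re)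
    (fun l => (Complex.le_def.1 (hx l)).1)
    fun l hl => by rw [hxy l (by rw [hx_re, hl, Complex.ofReal_zero]), Complex.zero_re]
  have hadd := hθ ((C : ℂ) • x + y) (fun l => by
    rw [map_add, map_smul, smul_eq_mul, hx_re, hy_re]
    exact_mod_cast by linarith [(abs_le.1 (hC l)).1]) i
  have hsub := hθ ((C : ℂ) • x - y) (fun l => by
    rw [map_sub, map_smul, smul_eq_mul, hx_re, hy_re]
    exact_mod_cast by linarith [(abs_le.1 (hC l)).2]) i
  simp only [map_add, map_sub, map_smulₛₗ, hi, smul_zero, zero_add, zero_sub] at hadd hsub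
  exact le_antisymm (neg_nonneg.1 hsub) hadd

theorem exists_functional_comp_eq_conj (hu : ∀ i, f i u = 1)
    (cone_span : Submodule.span ℂ {x | ∀ i, 0 ≤ f i x} = ⊤) (θ_involutive : Function.Involutive θ)
    (θ_one : θ u = u) (hθ : ∀ x, (∀ i, 0 ≤ f i x) → ∀ i, 0 ≤ f i (θ x)) {j : ι} {x : V}
    (hj : f j x = 0) (hx : ∀ i ≠ j, 0 < f i x) :
    ∃ i, ∀ y, f i (θ y) = starRingEnd ℂ (f j y) := by
  have x_nonneg (i) : 0 ≤ f i x := by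
    rcases eq_or_ne i j with rfl | hij
    exacts [hj.ge, (hx i hij).le]
  obtain ⟨i, hi⟩ : ∃ i, f i (θ x) = 0 := by
    by_contra! hne
    have h := map_eq_zero_of_positive hθ (i := j) (x := θ x) (y := u) (hθ x x_nonneg)
      (by rw [θ_involutive, hj]) (fun l => by rw [hu, Complex.one_im])
      (fun l hl => absurd hl (hne l))
    rw [θ_one, hu] at h
    exact one_ne_zero h
  refine ⟨i, fun y => ?_⟩
  have hy : y ∈ Submodule.span ℂ {x | ∀ i, 0 ≤ f i x} := cone_span ▸ Submodule.mem_top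
  induction hy using Submodule.span_induction with
  | zero => simp
  | add y z _ _ hy hz => simp only [map_add, hy, hz]
  | smul c y _ hy => simp only [map_smulₛₗ, smul_eq_mul, map_mul, hy, RingHom.id_apply]
  | mem y hy =>
    have im_eq_zero (l) : (f l y).im = 0 := (Complex.le_def.1 (hy l)).2.symm
    have h := map_eq_zero_of_positive hθ (y := y - f j y • u) x_nonneg hi
      (fun l => by simp [hu, im_eq_zero])
      (fun l hl => by
        rw [show l = j from by_contra fun hlj => (hx l hlj).ne' hl]
        simp [hu])
    simpa [θ_one, hu, sub_eq_zero] using h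

theorem exists_perm_functional_comp_eq_conj (hu : ∀ i, f i u = 1)
    (cone_span : Submodule.span ℂ {x | ∀ i, 0 ≤ f i x} = ⊤) (θ_involutive : Function.Involutive θ)
    (θ_one : θ u = u) (hθ : ∀ x, (∀ i, 0 ≤ f i x) → ∀ i, 0 ≤ f i (θ x)) {x : ι → V}
    (hx_self : ∀ j, f j (x j) = 0) (hx : ∀ i j, i ≠ j → 0 < f i (x j)) :
    ∃ σ : Equiv.Perm ι, ∀ j y, f (σ j) (θ y) = starRingEnd ℂ (f j y) := by
  choose σ hσ using fun j => exists_functional_comp_eq_conj hu cone_span θ_involutive θ_one hθ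
    (hx_self j) (fun i => hx i j)
  have hinj : Function.Injective σ := by
    intro i j hij
    by_contra hne
    have h := hσ i (x j)
    rw [hij, hσ j, hx_self, map_zero, eq_comm, map_eq_zero] at h
    exact (hx i j hne).ne' h
  exact ⟨.ofBijective σ (Finite.injective_iff_bijective.1 hinj), hσ⟩

end PolyhedralCone

section DiagonalEntries

variable {n : Type*} [Fintype n] [DecidableEq n]
  {X : Submodule ℂ (EuclideanSpace ℂ n →L[ℂ] EuclideanSpace ℂ n)}

/-- The diagonal matrix entries of the operators in a space of operators on `ℂⁿ`, as functionals on
this space. -/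
noncomputable def diagEntry (X : Submodule ℂ (EuclideanSpace ℂ n →L[ℂ] EuclideanSpace ℂ n))
    (i : n) : X →ₗ[ℂ] ℂ where
  toFun x := (x : EuclideanSpace ℂ n →L[ℂ] EuclideanSpace ℂ n) (EuclideanSpace.single i 1) i
  map_add' _ _ := rfl
  map_smul' _ _ := rfl

theorem diagEntry_eq {x : X} {M : Matrix n n ℂ} (hx : x.1 = Matrix.toEuclideanCLM (𝕜 := ℂ) M)
    (i : n) : diagEntry X i x = M i i := by
  change x.1 (EuclideanSpace.single i 1) i = M i i
  rw [hx, Matrix.ofLp_toEuclideanCLM]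
  simp

theorem norm_isGreatest_range_diagEntry [Nonempty n] {x : X} {d : n → ℂ}
    (hx : x.1 = Matrix.toEuclideanCLM (𝕜 := ℂ) (Matrix.diagonal d)) :
    IsGreatest (Set.range fun i => ‖diagEntry X i x‖) ‖x‖ := by
  have norm_eq : ‖x‖ = ‖d‖ := by
    rw [Submodule.coe_norm, hx, Matrix.l2_opNorm_toEuclideanCLM, Matrix.l2_opNorm_diagonal]
  simp only [diagEntry_eq hx, Matrix.diagonal_apply_eq, norm_eq]
  obtain ⟨i, hi⟩ := Finite.exists_max fun i => ‖d i‖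
  exact ⟨⟨i, le_antisymm (norm_le_pi_norm d i) ((pi_norm_le_iff_of_nonneg (norm_nonneg _)).2 hi)⟩,
    Set.forall_mem_range.2 (norm_le_pi_norm d)⟩

end DiagonalEntries

theorem crossRatio_eq_of_fractionalLinear {ι K : Type*} [Field K] {x y w : ι → K} {p q r s : K}
    (hw : ∀ j, w j = p + q * y j) (hw0 : ∀ j, w j ≠ 0) (hx : ∀ j, w j * x j = r + s * y j)
    (a b c d : ι) : (x a - x b) * (x c - x d) * ((y a - y c) * (y b - y d)) =
      (x a - x c) * (x b - x d) * ((y a - y b) * (y c - y d)) := by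
  have sub_eq (i j : ι) : w i * w j * (x i - x j) = (p * s - q * r) * (y i - y j) :=
    calc w i * w j * (x i - x j) = w j * (w i * x i) - w i * (w j * x j) := by ring
      _ = _ := by rw [hx, hx, hw, hw]; ring
  refine mul_left_cancel₀ (mul_ne_zero (mul_ne_zero (hw0 a) (hw0 b))
    (mul_ne_zero (hw0 c) (hw0 d))) ?_
  calc _ = w a * w b * (x a - x b) * (w c * w d * (x c - x d)) *
        ((y a - y c) * (y b - y d)) := by ring
    _ = w a * w c * (x a - x c) * (w b * w d * (x b - x d)) *
        ((y a - y b) * (y c - y d)) := by simp only [sub_eq]; ring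
    _ = _ := by ring

section Quadrilateral

/-- The vertices of a quadrilateral whose cross-ratio, in any order of the vertices, is not the
conjugate of its cross-ratio in the given order. -/
def vertex : Fin 4 → GaussianInt := ![0, 2, ⟨0, 1⟩, ⟨3, 2⟩]

theorem star_crossRatio_vertex_ne : ∀ σ : Equiv.Perm (Fin 4),
    star ((vertex 0 - vertex 1) * (vertex 2 - vertex 3)) *
      ((vertex (σ 0) - vertex (σ 2)) * (vertex (σ 1) - vertex (σ 3))) ≠
    star ((vertex 0 - vertex 2) * (vertex 1 - vertex 3)) *
      ((vertex (σ 0) - vertex (σ 1)) * (vertex (σ 2) - vertex (σ 3))) := by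
  decide

/-- For each vertex, a point from which it is farther away than the other vertices. -/
def center : Fin 4 → GaussianInt := ![⟨3, 3⟩, ⟨0, 3⟩, 3, 0]

theorem norm_vertex_sub_center_lt {i j : Fin 4} (h : i ≠ j) :
    ‖(vertex i : ℂ) - center j‖ < ‖(vertex j : ℂ) - center j‖ := by
  have norm_lt : ∀ i j : Fin 4, i ≠ j →
      (vertex i - center j).norm < (vertex j - center j).norm := by decide
  rw [← sq_lt_sq₀ (norm_nonneg _) (norm_nonneg _), Complex.sq_norm, Complex.sq_norm,
    ← GaussianInt.toComplex_sub, ← GaussianInt.toComplex_sub, ← GaussianInt.intCast_real_norm,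
    ← GaussianInt.intCast_real_norm]
  exact_mod_cast norm_lt i j h

theorem not_isometric_conj_of_vertex {V : Type*} [SeminormedAddCommGroup V] [Module ℂ V]
    {f : Fin 4 → V →ₗ[ℂ] ℂ} (norm_isGreatest : ∀ x, IsGreatest (Set.range fun i => ‖f i x‖) ‖x‖)
    {e a : V} (he : ∀ i, f i e = 1) (ha : ∀ i, f i a = vertex i)
    (exists_eq : ∀ x, ∃ p q : ℂ, p • e + q • a = x)
    {T : V →ₛₗ[starRingEnd ℂ] V} (hT : ∀ x, ‖T x‖ = ‖x‖) : False := by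
  have map_eq (i : Fin 4) (p q : ℂ) : f i (p • e + q • a) = p + q * vertex i := by
    simp only [map_add, map_smul, he, ha, smul_eq_mul, mul_one]
  obtain ⟨σ, w, hσ⟩ := exists_perm_functional_comp_eq_mul_conj norm_isGreatest hT
    (x := fun j => (-center j : ℂ) • e + (1 : ℂ) • a) fun i j hij => by
      simpa only [map_eq, one_mul, neg_add_eq_sub] using norm_vertex_sub_center_lt hij
  obtain ⟨p, q, hpq⟩ := exists_eq (T e)
  obtain ⟨r, s, hrs⟩ := exists_eq (T a)
  have hw (j) : w j = p + q * vertex (σ j) := by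
    simpa only [← hpq, map_eq, he, map_one, mul_one] using ((hσ j).2 e).symm
  have hwx (j) : w j * starRingEnd ℂ (vertex j) = r + s * vertex (σ j) := by
    simpa only [← hrs, map_eq, ha] using ((hσ j).2 a).symm
  refine star_crossRatio_vertex_ne σ (GaussianInt.toComplex_inj.1 ?_)
  simpa [GaussianInt.toComplex_star] using
    crossRatio_eq_of_fractionalLinear hw (fun j => (hσ j).1) hwx 0 1 2 3

/-- The normal operator on `ℂ⁴` whose eigenvalues are the vertices of the quadrilateral. -/
noncomputable def vertexOp :
    EuclideanSpace ℂ (ULift.{u} (Fin 4)) →L[ℂ] EuclideanSpace ℂ (ULift.{u} (Fin 4)) :=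
  Matrix.toEuclideanCLM (𝕜 := ℂ) (Matrix.diagonal fun i => (vertex i.down : ℂ))

theorem smul_one_add_smul_vertexOp (p q : ℂ) : p • 1 + q • vertexOp.{u} =
    Matrix.toEuclideanCLM (𝕜 := ℂ) (Matrix.diagonal fun i => p + q * vertex i.down) := by
  rw [vertexOp, ← map_one (Matrix.toEuclideanCLM (𝕜 := ℂ)), ← map_smul, ← map_smul, ← map_add,
    ← Matrix.diagonal_one, ← Matrix.diagonal_smul, ← Matrix.diagonal_smul, Matrix.diagonal_add]
  congr 2
  ext i
  simp

/-- The span of `1` and the normal operator `vertexOp`, as a (unital) operator space. -/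
noncomputable def quadrilateralSpace (k : OpKind) (hk : k ≠ .system) : OpCat.{u} k ℂ ℂ where
  H := EuclideanSpace ℂ (ULift.{u} (Fin 4))
  X := Submodule.span ℂ {1, vertexOp}
  one_mem _ := Submodule.subset_span (Set.mem_insert _ _)
  star_mem h := absurd h hk

theorem norm_isGreatest_range_diagEntry_span (x : Submodule.span ℂ {1, vertexOp.{u}}) :
    IsGreatest (Set.range fun i : Fin 4 => ‖diagEntry _ (ULift.up i) x‖) ‖x‖ := by
  obtain ⟨p, q, h⟩ := Submodule.mem_span_pair.1 x.2
  have := norm_isGreatest_range_diagEntry (h.symm.trans (smul_one_add_smul_vertexOp p q))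
  rwa [← Equiv.ulift.symm.surjective.range_comp] at this

theorem not_isometric_conj_span_vertexOp
    {T : Submodule.span ℂ {1, vertexOp.{u}} →ₛₗ[starRingEnd ℂ] Submodule.span ℂ {1, vertexOp.{u}}}
    (hT : ∀ x, ‖T x‖ = ‖x‖) : False := by
  refine not_isometric_conj_of_vertex
    (V := Submodule.span ℂ {1, vertexOp.{u}}) (f := fun i => diagEntry _ ⟨i⟩)
    (e := ⟨1, Submodule.subset_span (Set.mem_insert _ _)⟩)
    (a := ⟨vertexOp, Submodule.subset_span (Set.mem_insert_of_mem _ rfl)⟩)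
    ?_ (fun i => ?_) (fun i => ?_) (fun x => ?_) hT
  · exact norm_isGreatest_range_diagEntry_span
  · exact (diagEntry_eq (map_one (Matrix.toEuclideanCLM (𝕜 := ℂ))).symm _).trans
      (Matrix.one_apply_eq _)
  · exact (diagEntry_eq rfl _).trans (Matrix.diagonal_apply_eq _ _)
  · obtain ⟨p, q, h⟩ := Submodule.mem_span_pair.1 x.2
    exact ⟨p, q, Subtype.ext h⟩

theorem isEmpty_iso_quadrilateralSpace {k : OpKind} (hk : k ≠ .system) (A : OpCat.{u} k ℝ ℝ) :
    IsEmpty (A.complexify ≅ quadrilateralSpace k hk) := by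
  refine ⟨fun φ => ?_⟩
  obtain ⟨θ, θ_involutive, hθ⟩ := exists_conjugation φ
  have norm_le (x) : ‖θ x‖ ≤ ‖x‖ := hθ.norm_le hk x
  exact not_isometric_conj_span_vertexOp (T := θ) fun x =>
    (norm_le x).antisymm (by simpa only [θ_involutive x] using norm_le (θ x))

end Quadrilateral

section PosSemidef

open Matrix
open scoped ComplexOrder

variable {ι n m : Type*}

theorem posSemidef_of_trace_nonneg_of_det_nonneg {M : Matrix (Fin 2) (Fin 2) ℂ} (hM : M.IsHermitian)
    (trace_nonneg : 0 ≤ M.trace) (det_nonneg : 0 ≤ M.det) : M.PosSemidef := by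
  rw [hM.trace_eq_sum_eigenvalues, Fin.sum_univ_two, ← RCLike.ofReal_add,
    RCLike.ofReal_nonneg] at trace_nonneg
  rw [hM.det_eq_prod_eigenvalues, Fin.prod_univ_two, ← RCLike.ofReal_mul,
    RCLike.ofReal_nonneg] at det_nonneg
  refine hM.posSemidef_iff_eigenvalues_nonneg.2 fun i => ?_
  by_contra! h
  fin_cases i <;> simp only [Fin.zero_eta, Fin.mk_one, Pi.zero_apply] at h <;> nlinarith

theorem posSemidef_comp_fromBlocks_diagonal [Finite ι] [Finite n] [Finite m] [DecidableEq n]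
    {D : Matrix ι ι (n → ℂ)} {P : Matrix ι ι (Matrix m m ℂ)}
    (hD : ∀ i, (D.map fun d => d i).PosSemidef) (hP : (comp ι ι m m ℂ P).PosSemidef) :
    (comp ι ι (n ⊕ m) (n ⊕ m) ℂ
      (of fun a b => fromBlocks (diagonal (D a b)) 0 0 (P a b))).PosSemidef := by
  cases nonempty_fintype ι
  cases nonempty_fintype n
  cases nonempty_fintype m
  refine PosSemidef.of_dotProduct_mulVec_nonneg ?_ fun v => ?_
  · ext ⟨a, s⟩ ⟨b, t⟩
    rcases s with i | s <;> rcases t with j | t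
    · rcases eq_or_ne i j with rfl | hij
      · simpa using (hD i).1.apply a b
      · simp [hij, hij.symm]
    · simp
    · simp
    · simpa using hP.1.apply (a, s) (b, t)
  · have form_eq : star v ⬝ᵥ (comp ι ι (n ⊕ m) (n ⊕ m) ℂ
          (of fun a b => fromBlocks (diagonal (D a b)) 0 0 (P a b)) *ᵥ v) =
        ∑ i, star (fun a => v (a, Sum.inl i)) ⬝ᵥ
          ((D.map fun d => d i) *ᵥ fun a => v (a, Sum.inl i)) +
        star (fun p : ι × m => v (p.1, Sum.inr p.2)) ⬝ᵥ
          (comp ι ι m m ℂ P *ᵥ fun p => v (p.1, Sum.inr p.2)) := by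
      simp only [dotProduct, mulVec, Fintype.sum_prod_type, Fintype.sum_sum_type, Pi.star_apply,
        comp_apply, of_apply, fromBlocks_apply₁₁, fromBlocks_apply₁₂, fromBlocks_apply₂₁,
        fromBlocks_apply₂₂, diagonal_apply, Matrix.zero_apply, ite_mul, zero_mul, Finset.sum_ite_eq,
        Finset.mem_univ, if_true, Finset.sum_const_zero, add_zero, zero_add,
        Finset.sum_add_distrib, map_apply]
      rw [Finset.sum_comm]
    rw [form_eq]
    exact add_nonneg (Finset.sum_nonneg fun i _ => (hD i).dotProduct_mulVec_nonneg _)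
      (hP.dotProduct_mulVec_nonneg _)

variable [Fintype n] [DecidableEq n]

theorem isPositive_toEuclideanCLM_iff {M : Matrix n n ℂ} :
    (toEuclideanCLM (𝕜 := ℂ) M).IsPositive ↔ M.PosSemidef :=
  (LinearMap.isPositive_toContinuousLinearMap_iff _).trans isPositive_toEuclideanLin_iff

theorem matPos_iff_posSemidef_comp [Fintype ι]
    {X : Submodule ℂ (EuclideanSpace ℂ n →L[ℂ] EuclideanSpace ℂ n)} {x : Matrix ι ι X}
    {M : Matrix ι ι (Matrix n n ℂ)} (hx : ∀ a b, (x a b).1 = toEuclideanCLM (𝕜 := ℂ) (M a b)) :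
    MatPos x ↔ (comp ι ι n n ℂ M).PosSemidef := by
  classical
  rw [← isPositive_toEuclideanCLM_iff]
  refine isPositive_iff_of_intertwine _ _ (fun v => WithLp.toLp 2 fun p : ι × n => v p.1 p.2)
    (fun w => ⟨WithLp.toLp 2 fun a => WithLp.toLp 2 fun i => w (a, i), rfl⟩) (fun v w => ?_)
    fun v => ?_
  · simp only [PiLp.inner_apply, Fintype.sum_prod_type]
  · ext ⟨a, i⟩
    simp only [matOp_apply, hx, ofLp_toEuclideanCLM, mulVec, dotProduct, comp_apply,
      Fintype.sum_prod_type, WithLp.ofLp_sum, Finset.sum_apply]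

end PosSemidef

section Octahedron

open Matrix
open scoped ComplexOrder

/-- The vertices of an octahedron in `ℝ³` without affine symmetries, in homogeneous coordinates: the
row `(1, a, b, c)` is the vertex `(a, b, c)`. -/
def octVertex : Matrix (Fin 6) (Fin 4) ℤ :=
  !![1, 6, 0, 0; 1, -7, 0, 0; 1, 0, 6, 0; 1, 0, -8, 0; 1, 0, 0, 7; 1, 0, 0, -8]

/-- For each vertex of the octahedron, the coefficients of an affine function which vanishes there
and is positive at the other vertices. -/
def octSupport : Matrix (Fin 6) (Fin 4) ℤ :=
  !![6, -1, 0, 0; 7, 1, 0, 0; 6, 0, -1, 0; 8, 0, 1, 0; 7, 0, 0, -1; 8, 0, 0, 1]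

/-- Two affine dependences between the vertices of the octahedron, which express that its three
diagonals meet at the origin. -/
def octRelation : Matrix (Fin 2) (Fin 6) ℤ :=
  !![98, 84, -104, -78, 0, 0; 105, 90, 0, 0, -104, -91]

theorem octRelation_mul_octVertex : octRelation * octVertex = 0 := by decide

theorem eq_one_of_octRelation_mul_submatrix_eq_zero : ∀ σ : Equiv.Perm (Fin 6),
    octRelation * octVertex.submatrix σ id = 0 → σ = 1 := by
  decide +kernel

/-- The value at a vertex of the octahedron of the affine function with coefficients `z`. -/
noncomputable def octEval (i : Fin 6) : (Fin 4 → ℂ) →ₗ[ℂ] ℂ :=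
  LinearMap.proj i ∘ₗ (octVertex.map ((↑) : ℤ → ℂ)).mulVecLin

theorem octEval_apply (i : Fin 6) (z : Fin 4 → ℂ) :
    octEval i z = ∑ m, (octVertex i m : ℂ) * z m := rfl

theorem sum_octRelation_mul_octEval (k : Fin 2) (z : Fin 4 → ℂ) :
    ∑ j, (octRelation k j : ℂ) * octEval j z = 0 := by
  have h : octRelation.map (Int.castRingHom ℂ) *ᵥ (octVertex.map (Int.castRingHom ℂ) *ᵥ z) = 0 := by
    rw [mulVec_mulVec, ← Matrix.map_mul, octRelation_mul_octVertex,
      Matrix.map_zero _ (map_zero _), zero_mulVec]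
  exact congrFun h k

theorem octEval_single_zero (i : Fin 6) : octEval i (Pi.single 0 1) = 1 := by
  have h : ∀ i, octVertex i 0 = 1 := by decide
  simp [octEval_apply, Pi.single_apply, h]

theorem octEval_intCast (i : Fin 6) (a : Fin 4 → ℤ) :
    octEval i (fun m => (a m : ℂ)) = ((octVertex *ᵥ a) i : ℤ) := by
  simp [octEval_apply, mulVec, dotProduct]

theorem octEval_octSupport_self (j : Fin 6) :
    octEval j (fun m => (octSupport j m : ℂ)) = 0 := by
  have h : ∀ j, (octVertex *ᵥ octSupport j) j = 0 := by decide
  rw [octEval_intCast, h, Int.cast_zero]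

theorem octEval_octSupport_pos {i j : Fin 6} (hij : i ≠ j) :
    0 < octEval i (fun m => (octSupport j m : ℂ)) := by
  have h : ∀ i j, i ≠ j → 0 < (octVertex *ᵥ octSupport j) i := by decide
  rw [octEval_intCast]
  exact_mod_cast h i j hij

theorem span_octEval_nonneg : Submodule.span ℂ {z | ∀ i, 0 ≤ octEval i z} = ⊤ := by
  have mem_span (j) : (fun m => (octSupport j m : ℂ)) ∈
      Submodule.span ℂ {z | ∀ i, 0 ≤ octEval i z} := by
    refine Submodule.subset_span fun i => ?_
    rcases eq_or_ne i j with rfl | hij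
    exacts [(octEval_octSupport_self i).ge, (octEval_octSupport_pos hij).le]
  rw [Submodule.eq_top_iff']
  intro z
  have z_eq : z = ((z 0 - 7 * z 1 - 8 * z 2 - 8 * z 3) / 13) •
      ((fun m => (octSupport 0 m : ℂ)) + fun m => (octSupport 1 m : ℂ)) +
      z 1 • (fun m => (octSupport 1 m : ℂ)) + z 2 • (fun m => (octSupport 3 m : ℂ)) +
      z 3 • fun m => (octSupport 5 m : ℂ) := by
    ext m
    fin_cases m <;> simp [octSupport]
    ring
  rw [z_eq]
  have add_mem_mem := Submodule.add_mem _ (mem_span 0) (mem_span 1)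
  exact Submodule.add_mem _ (Submodule.add_mem _ (Submodule.add_mem _
    (Submodule.smul_mem _ _ add_mem_mem) (Submodule.smul_mem _ _ (mem_span 1)))
    (Submodule.smul_mem _ _ (mem_span 3))) (Submodule.smul_mem _ _ (mem_span 5))

theorem octEval_eq (i : Fin 6) (z : Fin 4 → ℂ) : octEval i z = ![z 0 + 6 * z 1, z 0 - 7 * z 1,
    z 0 + 6 * z 2, z 0 - 8 * z 2, z 0 + 7 * z 3, z 0 - 8 * z 3] i := by
  rw [octEval_apply, Fin.sum_univ_four]
  fin_cases i <;> simp [octVertex, sub_eq_add_neg]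

theorem eq_of_octEval_eq {a b : Fin 4 → ℂ} (h : ∀ i, octEval i a = octEval i b) : a = b := by
  obtain ⟨h₀, h₁, h₂, h₃, h₄, h₅⟩ : a 0 + 6 * a 1 = b 0 + 6 * b 1 ∧ a 0 - 7 * a 1 = b 0 - 7 * b 1 ∧
      a 0 + 6 * a 2 = b 0 + 6 * b 2 ∧ a 0 - 8 * a 2 = b 0 - 8 * b 2 ∧
      a 0 + 7 * a 3 = b 0 + 7 * b 3 ∧ a 0 - 8 * a 3 = b 0 - 8 * b 3 := by
    simpa [octEval_eq, Fin.forall_fin_succ] using h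
  ext m
  match m with
  | 0 => linear_combination (7 * h₀ + 6 * h₁) / 13
  | 1 => linear_combination (h₀ - h₁) / 13
  | 2 => linear_combination (h₂ - h₃) / 14
  | 3 => linear_combination (h₄ - h₅) / 15

theorem eq_star_of_octEval_nonneg {θ : (Fin 4 → ℂ) →ₛₗ[starRingEnd ℂ] (Fin 4 → ℂ)}
    (θ_involutive : Function.Involutive θ) (θ_one : θ (Pi.single 0 1) = Pi.single 0 1)
    (hθ : ∀ z, (∀ i, 0 ≤ octEval i z) → ∀ i, 0 ≤ octEval i (θ z)) (z : Fin 4 → ℂ) :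
    θ z = star z := by
  obtain ⟨σ, hσ⟩ := exists_perm_functional_comp_eq_conj octEval_single_zero span_octEval_nonneg
    θ_involutive θ_one hθ octEval_octSupport_self fun i j => octEval_octSupport_pos
  obtain rfl : σ = 1 := eq_one_of_octRelation_mul_submatrix_eq_zero σ <| by
    ext k m
    have h := congrArg (starRingEnd ℂ) (sum_octRelation_mul_octEval k (θ (Pi.single m 1)))
    simp only [map_sum, map_mul, map_intCast, map_zero, ← hσ, θ_involutive _] at h
    simp only [octEval_apply, Pi.single_apply, mul_ite, mul_one, mul_zero, Finset.sum_ite_eq',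
      Finset.mem_univ, if_true] at h
    exact_mod_cast h
  refine eq_of_octEval_eq fun i => ?_
  simpa [octEval_apply] using hσ i z

/-- The matrix `z₀ + 3 (z₁ σ₁ + z₂ σ₂ + z₃ σ₃)`, where the `σᵢ` are the Pauli matrices. For real `z`
it is positive semidefinite if the affine function with coefficients `z` is nonnegative on the
octahedron, which contains the ball of radius `3` around the origin. -/
noncomputable def pauli (z : Fin 4 → ℂ) : Matrix (Fin 2) (Fin 2) ℂ :=
  !![z 0 + 3 * z 3, 3 * (z 1 - Complex.I * z 2); 3 * (z 1 + Complex.I * z 2), z 0 - 3 * z 3]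

theorem conjTranspose_pauli (z : Fin 4 → ℂ) : (pauli z)ᴴ = pauli (star z) := by
  ext i j
  fin_cases i <;> fin_cases j <;> simp [pauli, sub_eq_add_neg]

theorem posSemidef_pauli {z : Fin 4 → ℂ} (hz : ∀ i, 0 ≤ octEval i z) : (pauli z).PosSemidef := by
  have star_z : star z = z := eq_of_octEval_eq fun i => by
    rw [← (Complex.conj_eq_iff_im (z := octEval i z)).2 (Complex.le_def.1 (hz i)).2.symm]
    simp [octEval_apply]
  obtain ⟨x, rfl⟩ : ∃ x : Fin 4 → ℝ, z = fun m => (x m : ℂ) :=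
    ⟨fun m => (z m).re, funext fun m => (Complex.conj_eq_iff_re.1 (congrFun star_z m)).symm⟩
  obtain ⟨h₀, h₁, h₂, h₃, h₄, h₅⟩ : 0 ≤ x 0 + 6 * x 1 ∧ 7 * x 1 ≤ x 0 ∧ 0 ≤ x 0 + 6 * x 2 ∧
      8 * x 2 ≤ x 0 ∧ 0 ≤ x 0 + 7 * x 3 ∧ 8 * x 3 ≤ x 0 := by
    simpa [octEval_eq, Fin.forall_fin_succ, ← Complex.ofReal_ofNat, ← Complex.ofReal_mul,
      ← Complex.ofReal_add, ← Complex.ofReal_sub, Complex.zero_le_real] using hz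
  refine posSemidef_of_trace_nonneg_of_det_nonneg (by rw [IsHermitian, conjTranspose_pauli, star_z])
    ?_ ?_
  · have trace_eq : (pauli fun m => (x m : ℂ)).trace = (2 * x 0 : ℝ) := by
      simp [pauli, trace_fin_two]
      ring
    rw [trace_eq, Complex.zero_le_real]
    linarith
  · have det_eq : (pauli fun m => (x m : ℂ)).det =
        (x 0 ^ 2 - 9 * (x 1 ^ 2 + x 2 ^ 2 + x 3 ^ 2) : ℝ) := by
      simp [pauli, det_fin_two]
      linear_combination 9 * (x 2 : ℂ) ^ 2 * Complex.I_sq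
    rw [det_eq, Complex.zero_le_real]
    nlinarith

/-- The matrix with the values at the vertices of the octahedron on the diagonal, followed by a
`2 × 2` block which obstructs complete positivity of the conjugation. -/
noncomputable def octMat (z : Fin 4 → ℂ) :
    Matrix (ULift.{u} (Fin 6) ⊕ Fin 2) (ULift.{u} (Fin 6) ⊕ Fin 2) ℂ :=
  fromBlocks (diagonal fun i => octEval i.down z) 0 0 (pauli z)

theorem posSemidef_comp_octMat {ι : Type*} [Finite ι] {x : Matrix ι ι (Fin 4 → ℂ)}
    (eval_posSemidef : ∀ i, (x.map (octEval i)).PosSemidef)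
    (pauli_posSemidef : (comp _ _ _ _ ℂ (x.map pauli)).PosSemidef) :
    (comp _ _ _ _ ℂ (x.map octMat.{u})).PosSemidef :=
  posSemidef_comp_fromBlocks_diagonal (n := ULift.{u} (Fin 6))
    (D := x.map fun z i => octEval i.down z) (P := x.map pauli)
    (fun i => eval_posSemidef i.down) pauli_posSemidef

/-- The matrices `octMat z`, as operators on `ℂ⁸`. -/
noncomputable def octOp : (Fin 4 → ℂ) →ₗ[ℂ]
    EuclideanSpace ℂ (ULift.{u} (Fin 6) ⊕ Fin 2) →L[ℂ]
      EuclideanSpace ℂ (ULift.{u} (Fin 6) ⊕ Fin 2) where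
  toFun z := toEuclideanCLM (𝕜 := ℂ) (octMat z)
  map_add' a b := by
    rw [← map_add, octMat, octMat, octMat, fromBlocks_add, diagonal_add]
    congr 2
    · simp
    · simp
    · simp
    · ext i j
      fin_cases i <;> fin_cases j <;> simp [pauli] <;> ring
  map_smul' c a := by
    rw [← map_smul, octMat, octMat, fromBlocks_smul, ← diagonal_smul]
    congr 2
    · exact congrArg diagonal (funext fun i => map_smul (octEval i.down) c a)
    · simp
    · simp
    · ext i j
      fin_cases i <;> fin_cases j <;> simp [pauli] <;> ring

theorem octOp_apply (z : Fin 4 → ℂ) : octOp.{u} z = toEuclideanCLM (𝕜 := ℂ) (octMat z) := rfl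

theorem star_octOp (z : Fin 4 → ℂ) : star (octOp.{u} z) = octOp (star z) := by
  rw [octOp_apply, octOp_apply, ← map_star, star_eq_conjTranspose, octMat, octMat,
    fromBlocks_conjTranspose, diagonal_conjTranspose, conjTranspose_pauli, conjTranspose_zero,
    conjTranspose_zero]
  congr 3
  ext i
  simp [octEval_apply]

theorem octOp_single_zero : octOp.{u} (Pi.single 0 1) = 1 := by
  have pauli_eq : pauli (Pi.single 0 1) = 1 := by
    ext i j
    fin_cases i <;> fin_cases j <;> simp [pauli]
  rw [octOp_apply, octMat, pauli_eq]
  simp [octEval_single_zero]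

theorem isPositive_octOp_iff {z : Fin 4 → ℂ} :
    (octOp.{u} z).IsPositive ↔ ∀ i, 0 ≤ octEval i z := by
  rw [octOp_apply, isPositive_toEuclideanCLM_iff]
  refine ⟨fun h i => ?_, fun hz => ?_⟩
  · simpa [octMat] using h.diag_nonneg (i := Sum.inl (ULift.up i))
  · have eval_posSemidef (i) : ((of fun _ _ : Unit => z).map (octEval i)).PosSemidef := by
      convert PosSemidef.diagonal fun _ : Unit => hz i
      ext
      simp
    exact (posSemidef_comp_octMat eval_posSemidef
      ((posSemidef_pauli hz).submatrix Prod.snd)).submatrix fun s => ((), s)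

theorem octOp_injective : Function.Injective octOp.{u} := fun a b h => by
  have mat_eq : octMat.{u} a = octMat b := (toEuclideanCLM (𝕜 := ℂ)).injective h
  refine eq_of_octEval_eq fun i => ?_
  simpa [octMat] using congrFun₂ mat_eq (Sum.inl (ULift.up i)) (Sum.inl (ULift.up i))

theorem apply_octOp_eq_octOp_star
    {θ : LinearMap.range octOp.{u} →ₛₗ[starRingEnd ℂ] LinearMap.range octOp.{u}}
    (θ_involutive : Function.Involutive θ) (θ_one : PreservesOne θ) (hθ : CompletelyPositive θ)
    (z : Fin 4 → ℂ) : (θ ⟨octOp z, z, rfl⟩).1 = octOp (star z) := by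
  let e := LinearEquiv.ofInjective octOp.{u} octOp_injective
  let θ' : (Fin 4 → ℂ) →ₛₗ[starRingEnd ℂ] (Fin 4 → ℂ) :=
    e.symm.toLinearMap.comp (θ.comp e.toLinearMap)
  have octOp_θ' (z) : octOp (θ' z) = (θ ⟨octOp z, z, rfl⟩).1 :=
    congrArg Subtype.val (e.apply_symm_apply (θ (e z)))
  rw [← octOp_θ', eq_star_of_octEval_nonneg (θ := θ')]
  · intro z
    simp [θ', θ_involutive (e _)]
  · refine octOp_injective ?_
    exact (octOp_θ' _).trans ((θ_one _ octOp_single_zero).trans octOp_single_zero.symm)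
  · intro z hz
    rw [← isPositive_octOp_iff, octOp_θ']
    exact hθ.isPositive (isPositive_octOp_iff.2 hz)

/-- The coefficients of a matrix which is positive over `octSystem`, while its entrywise conjugate
is not: its block of Pauli matrices is `5 + 6 w wᴴ` with `w = e₀ ⊗ e₀ + e₁ ⊗ e₁`, and conjugation
amounts to a partial transposition. -/
noncomputable def octWitness : Matrix (Fin 2) (Fin 2) (Fin 4 → ℂ) :=
  !![![8, 0, 0, 1], ![0, 1, Complex.I, 0]; ![0, 1, -Complex.I, 0], ![8, 0, 0, -1]]

theorem posSemidef_octEval_octWitness (i : Fin 6) :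
    (octWitness.map (octEval i)).PosSemidef := by
  refine posSemidef_of_trace_nonneg_of_det_nonneg ?_ ?_ ?_
  · ext a b
    fin_cases i <;> fin_cases a <;> fin_cases b <;> simp [octWitness, octEval_eq]
  · fin_cases i <;> simp [octWitness, octEval_eq, trace_fin_two] <;> norm_num
  · fin_cases i <;> simp [octWitness, octEval_eq, det_fin_two] <;> ring_nf <;> norm_num

theorem posSemidef_comp_pauli_octWitness :
    (comp _ _ _ _ ℂ (octWitness.map pauli)).PosSemidef := by
  have comp_eq : comp _ _ _ _ ℂ (octWitness.map pauli) = (5 : ℂ) • 1 +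
      (6 : ℂ) • vecMulVec (fun p => (1 : Matrix (Fin 2) (Fin 2) ℂ) p.1 p.2)
        (star fun p => (1 : Matrix (Fin 2) (Fin 2) ℂ) p.1 p.2) := by
    ext ⟨a, i⟩ ⟨b, j⟩
    fin_cases a <;> fin_cases b <;> fin_cases i <;> fin_cases j <;>
      simp [octWitness, pauli, vecMulVec_apply] <;> norm_num
  rw [comp_eq]
  exact (PosSemidef.one.smul (by norm_num)).add
    ((posSemidef_vecMulVec_self_star _).smul (by norm_num))

theorem not_posSemidef_comp_octMat_star_octWitness :
    ¬(comp _ _ _ _ ℂ (octWitness.map fun z => octMat.{u} (star z))).PosSemidef := by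
  intro h
  have minor_eq : (comp _ _ _ _ ℂ (octWitness.map fun z => octMat.{u} (star z))).submatrix
      ![(0, Sum.inr 1), (1, Sum.inr 0)] ![(0, Sum.inr 1), (1, Sum.inr 0)] = !![5, 6; 6, 5] := by
    ext a b
    fin_cases a <;> fin_cases b <;> simp [octWitness, octMat, pauli, map_ofNat] <;> norm_num
  have det_nonneg := (h.submatrix ![(0, Sum.inr 1), (1, Sum.inr 0)]).det_nonneg
  rw [minor_eq, det_fin_two_of] at det_nonneg
  norm_num at det_nonneg

theorem not_completelyPositive_conj_range_octOp
    {θ : LinearMap.range octOp.{u} →ₛₗ[starRingEnd ℂ] LinearMap.range octOp.{u}}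
    (θ_involutive : Function.Involutive θ) (θ_one : PreservesOne θ) (hθ : CompletelyPositive θ) :
    False := by
  refine not_posSemidef_comp_octMat_star_octWitness
    ((matPos_iff_posSemidef_comp fun a b => ?_).1 (hθ 2 (octWitness.map octOp.rangeRestrict)
      ((matPos_iff_posSemidef_comp (M := octWitness.map octMat) fun a b => rfl).2 ?_)))
  · exact apply_octOp_eq_octOp_star θ_involutive θ_one hθ (octWitness a b)
  · exact posSemidef_comp_octMat posSemidef_octEval_octWitness posSemidef_comp_pauli_octWitness

/-- The range of `octOp`, as an operator system. -/
noncomputable def octSystem : OpCat.{u} .system ℂ ℂ where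
  H := EuclideanSpace ℂ (ULift.{u} (Fin 6) ⊕ Fin 2)
  X := LinearMap.range octOp
  one_mem _ := ⟨_, octOp_single_zero⟩
  star_mem _ := by
    rintro _ ⟨z, rfl⟩
    exact ⟨star z, (star_octOp z).symm⟩

theorem isEmpty_iso_octSystem (A : OpCat.{u} .system ℝ ℝ) :
    IsEmpty (A.complexify ≅ octSystem) := by
  refine ⟨fun φ => ?_⟩
  obtain ⟨θ, θ_involutive, hθ⟩ := exists_conjugation φ
  exact not_completelyPositive_conj_range_octOp (θ := θ) θ_involutive hθ.1 hθ.2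

end Octahedron

section EssSurj

theorem essSurj_of_comp {C D E : Type*} [Category* C] [Category* D] [Category* E]
    {F : C ⥤ D} {G : D ⥤ E} (h : (F ⋙ G).EssSurj) : G.EssSurj where
  mem_essImage Z :=
    let ⟨A, e⟩ := h.mem_essImage Z
    ⟨F.obj A, e⟩

theorem exists_isEmpty_iso_complexify (k : OpKind) :
    ∃ Z : OpCat.{u} k ℂ ℂ, ∀ A : OpCat.{u} k ℝ ℝ, IsEmpty (A.complexify ≅ Z) := by
  by_cases hk : k = .system
  · subst hk
    exact ⟨octSystem, isEmpty_iso_octSystem⟩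
  · exact ⟨quadrilateralSpace k hk, isEmpty_iso_quadrilateralSpace hk⟩

theorem not_essSurj_complexification (k : OpKind) : ¬ (complexification.{u} k).EssSurj := by
  intro _
  obtain ⟨Z, hZ⟩ := exists_isEmpty_iso_complexify.{u} k
  exact (hZ _).false ((complexification k).objObjPreimageIso Z)

theorem not_essSurj_intermediateComplexification (k : OpKind) :
    ¬ (intermediateComplexification.{u} k).EssSurj := fun h =>
  not_essSurj_complexification k (essSurj_of_comp h)

variable (G : Type v) [Group G]

theorem not_essSurj_complexificationG (k : OpKind) : ¬ (complexificationG.{u} G k).EssSurj :=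
  fun _ => not_essSurj_complexification k
    (essSurj_of_forgetAction (F' := complexificationG G k) (Iso.refl _))

theorem not_essSurj_intermediateComplexificationG (k : OpKind) :
    ¬ (intermediateComplexificationG.{u} G k).EssSurj := fun h =>
  not_essSurj_complexificationG G k (essSurj_of_comp h)

end EssSurj

end OpSp

theorem mainTheorem12 (G : Type v) [Group G] :
    -- the twelve complexification functors: three kinds, from the real and from the intermediate
    -- category, without and with a group action
    (∀ k : OpSp.OpKind,
      ((OpSp.complexification.{u} k).Faithful ∧
        ¬ (OpSp.complexification.{u} k).Full ∧
        ¬ (OpSp.complexification.{u} k).EssSurj) ∧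
      ((OpSp.intermediateComplexification.{u} k).Faithful ∧
        ¬ (OpSp.intermediateComplexification.{u} k).Full ∧
        ¬ (OpSp.intermediateComplexification.{u} k).EssSurj) ∧
      ((OpSp.complexificationG.{u} G k).Faithful ∧
        ¬ (OpSp.complexificationG.{u} G k).Full ∧
        ¬ (OpSp.complexificationG.{u} G k).EssSurj) ∧
      ((OpSp.intermediateComplexificationG.{u} G k).Faithful ∧
        ¬ (OpSp.intermediateComplexificationG.{u} G k).Full ∧
        ¬ (OpSp.intermediateComplexificationG.{u} G k).EssSurj)) ∧
    -- the six forgetful functors from the complex to the real categories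
    (∀ k : OpSp.OpKind,
      ¬ (OpSp.forgetToReal.{u} k ℂ).EssSurj ∧
      ¬ (OpSp.forgetToRealG.{u} G k ℂ).EssSurj) ∧
    -- the quaternions are not in their essential images
    (∀ k : OpSp.OpKind,
      (∀ Z : OpSp.OpCat.{u} k ℂ ℂ,
        IsEmpty ((OpSp.forgetToReal.{u} k ℂ).obj Z ≅ OpSp.quaternionSpace.{u} k)) ∧
      (∀ Z : OpSp.GOpCat.{u} G k ℂ ℂ,
        IsEmpty ((OpSp.forgetToRealG.{u} G k ℂ).obj Z ≅
          (OpSp.quaternionSpace.{u} k).trivialAction G))) ∧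
    -- the six forgetful functors from unital operator spaces to operator spaces
    (¬ (OpSp.forgetUnit.{u} ℝ ℝ).EssSurj ∧
      ¬ (OpSp.forgetUnit.{u} ℂ ℂ).EssSurj ∧
      ¬ (OpSp.forgetUnit.{u} ℂ ℝ).EssSurj ∧
      ¬ (OpSp.forgetUnitG.{u} ℝ ℝ G).EssSurj ∧
      ¬ (OpSp.forgetUnitG.{u} ℂ ℂ G).EssSurj ∧
      ¬ (OpSp.forgetUnitG.{u} ℂ ℝ G).EssSurj) :=
  ⟨fun k => ⟨⟨inferInstance, OpSp.not_full_complexification k,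
      OpSp.not_essSurj_complexification k⟩,
    ⟨inferInstance, OpSp.not_full_intermediateComplexification k,
      OpSp.not_essSurj_intermediateComplexification k⟩,
    ⟨inferInstance, OpSp.not_full_complexificationG G k,
      OpSp.not_essSurj_complexificationG G k⟩,
    ⟨inferInstance, OpSp.not_full_intermediateComplexificationG G k,
      OpSp.not_essSurj_intermediateComplexificationG G k⟩⟩,
  fun k => ⟨OpSp.not_essSurj_forgetToReal k, OpSp.not_essSurj_forgetToRealG G k⟩,
  fun k => ⟨OpSp.isEmpty_iso_quaternionSpace k, OpSp.isEmpty_iso_quaternionSpaceG G k⟩,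
  OpSp.not_essSurj_forgetUnit ℝ ℝ, OpSp.not_essSurj_forgetUnit ℂ ℂ,
  OpSp.not_essSurj_forgetUnit ℂ ℝ, OpSp.not_essSurj_forgetUnitG ℝ ℝ G,
  OpSp.not_essSurj_forgetUnitG ℂ ℂ G, OpSp.not_essSurj_forgetUnitG ℂ ℝ G⟩
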